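/- Let $F=\mathrm{GF}(8)$, let $F\{X\}$ be the skew polynomial ring in which $X\alpha=\alpha^2X$ for all $\alpha\in F$, let $R=F\{X\}/(X^5)$, and let $Q=1+J(R)\le R^\times$, where $J(R)$ is the Jacobson radical of $R$. Let $C=F^\times$, embedded in $R^\times$ as the nonzero constants and acting on $R^\times$ by conjugation, and let $\mathcal G=\mathrm{Gal}(F/\mathrm{GF}(2))$, acting on $R$ by applying $\sigma\in\mathcal G$ to the coefficients (and fixing the image of $X$). With its natural action on $C$, these combine to an action of the semidirect product $C\mathcal G=C\rtimes\mathcal G$ on $R^\times$. A Suzuki $2$-group is a finite nonabelian $2$-group with more than one involution that has a solvable group of automorphisms permuting its involutions transitively. The Suzuki $2$-group of type $A$ of order $64$ is the group of all matrices $\begin{pmatrix}1&0&0\\a&1&0\\b&\theta(a)&1\end{pmatrix}$ with $a,b\in F$, where $1\neq\theta\in\mathcal G$ (up to isomorphism it does not depend on $\theta$). A group $S$ is a central extension of a Suzuki $2$-group if $S/Z$ is a Suzuki $2$-group for some subgroup $Z\le Z(S)$, and an iterated central extension of a Suzuki $2$-group if $S/Z_n(S)$ is a Suzuki $2$-group for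 some $n\ge2$, where $Z_n(S)$ is the $n$-th term of the upper central series. A group is homocyclic if it is a direct product of finitely many isomorphic finite cyclic groups. **Theorem.** (1) $|F|=8$, and $C\mathcal G$ is a Frobenius group of order $21$ with complement $\mathcal G$. (2) $Q$ has exactly one $C\mathcal G$-invariant subgroup $P$ of index $2$. (3) Let $G=P\rtimes C\mathcal G$. Then $G$ has exactly three real-valued irreducible complex characters. Moreover $|P|=2^{11}$, and $P$ is the unique Sylow $2$-subgroup of $G$. The group $P/Z_2(P)$ has order $64$, is a Suzuki $2$-group, and is isomorphic to the Suzuki $2$-group of type $A$ of order $64$ (for every choice of $\theta\ne1$). In particular $P$ is an iterated central extension of a Suzuki $2$-group. On the other hand, $P$ is neither cyclic, nor homocyclic, nor quaternion of order $8$, nor a central extension of a Suzuki $2$-group. (4) Consequently the following statement, obtained from a theorem of Moretó and Navarro by dropping the word "iterated", is false: "if a finite group $\Gamma$ has exactly three real-valued irreducible complex characters, then every Sylow $2$-subgroup $S$ of $\Gamma$ is cyclic, or is normal in $\Gamma$ and is homocyclic, quaternion of order $8$, or a central extension of a Suzuki $2$-group." -/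

import Mathlib

namespace ThreeReal

noncomputable section

/-! ### Real-valued irreducible characters -/

/-- The set of real-valued irreducible complex characters of a group `Γ`. -/
def realIrrChars (Γ : Type) [Group Γ] : Set (Γ → ℂ) :=
  {χ | (∃ (V : Type) (_ : AddCommGroup V) (_ : Module ℂ V) (_ : FiniteDimensional ℂ V)
        (ρ : Representation ℂ Γ V), ρ.IsIrreducible ∧ ρ.character = χ) ∧
      ∀ g, (χ g).im = 0}

/-! ### Suzuki 2-groups and related classes of groups -/

/-- A Suzuki 2-group: a nonabelian finite 2-group with more than one involution that has a
solvable group of automorphisms permuting its involutions transitively. -/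
structure IsSuzukiTwoGroup (S : Type*) [Group S] : Prop where
  finite : Finite S
  isPGroup : IsPGroup 2 S
  nonabelian : ∃ a b : S, a * b ≠ b * a
  two_involutions : ∃ a b : S, orderOf a = 2 ∧ orderOf b = 2 ∧ a ≠ b
  transitive : ∃ A : Subgroup (MulAut S), Group.IsSolvable A ∧
    ∀ a b : S, orderOf a = 2 → orderOf b = 2 → ∃ α ∈ A, α a = b

/-- `S` is a central extension of a Suzuki 2-group: some quotient of `S` by a central subgroup
is a Suzuki 2-group. -/
def IsCentralExtensionOfSuzuki (S : Type*) [Group S] : Prop :=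
  ∃ (Z : Subgroup S) (_ : Z.Normal), Z ≤ Subgroup.center S ∧ IsSuzukiTwoGroup (S ⧸ Z)

/-- `S` is an iterated central extension of a Suzuki 2-group: `S / Z_n(S)` is a Suzuki 2-group for
some `n ≥ 2`, where `Z_n(S)` is the `n`-th term of the upper central series. -/
def IsIteratedCentralExtensionOfSuzuki (S : Type*) [Group S] : Prop :=
  ∃ n : ℕ, 2 ≤ n ∧ IsSuzukiTwoGroup (S ⧸ Subgroup.upperCentralSeries S n)

/-- A homocyclic group: a direct product of finitely many isomorphic finite cyclic groups. -/
def IsHomocyclic (S : Type*) [Group S] : Prop :=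
  ∃ k n : ℕ, 0 < n ∧ Nonempty (S ≃* Multiplicative (Fin k → ZMod n))

/-- `T` is a Frobenius complement in `Γ`: a nontrivial proper subgroup meeting each of its
conjugates `g T g⁻¹`, `g ∉ T`, trivially. -/
def IsFrobeniusComplement {Γ : Type*} [Group Γ] (T : Subgroup Γ) : Prop :=
  T ≠ ⊥ ∧ T ≠ ⊤ ∧ ∀ g ∉ T, T ⊓ T.map (MulAut.conj g).toMonoidHom = ⊥

/-- The group `A(K, θ)` of all matrices `[[1,0,0],[a,1,0],[b,θ(a),1]]` with `a b : K`.
For `K = GF(2^n)` and `θ ≠ 1` an automorphism of odd order, this is the Suzuki 2-group of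
type A, of order `2^(2n)`. -/
def suzukiTypeA {K : Type*} [Field K] (θ : K ≃+* K) : Subgroup (GL (Fin 3) K) where
  carrier := {M | ∃ a b : K, (M : Matrix (Fin 3) (Fin 3) K) = !![1, 0, 0; a, 1, 0; b, θ a, 1]}
  one_mem' := ⟨0, 0, by
    ext i j; fin_cases i <;> fin_cases j <;> simp⟩
  mul_mem' := by
    rintro M N ⟨a, b, hM⟩ ⟨c, d, hN⟩
    refine ⟨a + c, b + θ a * c + d, ?_⟩
    rw [Units.val_mul, hM, hN]
    ext i j; fin_cases i <;> fin_cases j <;> simp [Matrix.mul_apply, Fin.sum_univ_three]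
  inv_mem' := by
    rintro M ⟨a, b, hM⟩
    refine ⟨-a, θ a * a - b, ?_⟩
    refine Units.inv_eq_of_mul_eq_one_right ?_
    rw [hM]
    ext i j; fin_cases i <;> fin_cases j <;> simp [Matrix.mul_apply, Fin.sum_univ_three]
    ring

/-! ### The field, the skew polynomial ring and its quotient -/

/-- The field with eight elements. -/
abbrev F : Type := GaloisField 2 3

/-- The Galois group of `F` over the field with two elements. -/
abbrev Gal8 : Type := F ≃ₐ[ZMod 2] F

/-- The action of `Multiplicative ℕ` on `F` by powers of the Frobenius map: it makes
`SkewPolynomial F` the skew polynomial ring `F{X}` with `X α = α² X`. -/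
instance frobeniusAction : MulSemiringAction (Multiplicative ℕ) F where
  smul n a := a ^ 2 ^ n.toAdd
  one_smul a := by change a ^ 2 ^ 0 = a; simp
  mul_smul m n a := by
    change a ^ 2 ^ (m.toAdd + n.toAdd) = (a ^ 2 ^ n.toAdd) ^ 2 ^ m.toAdd
    rw [← pow_mul, pow_add, mul_comm]
  smul_zero n := by change (0 : F) ^ 2 ^ n.toAdd = 0; simp
  smul_add n a b := by
    change (a + b) ^ 2 ^ n.toAdd = a ^ 2 ^ n.toAdd + b ^ 2 ^ n.toAdd
    exact add_pow_char_pow a b 2 n.toAdd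
  smul_one n := by change (1 : F) ^ 2 ^ n.toAdd = 1; simp
  smul_mul n a b := by
    change (a * b) ^ 2 ^ n.toAdd = a ^ 2 ^ n.toAdd * b ^ 2 ^ n.toAdd
    exact mul_pow _ _ _

theorem frobeniusAction_apply (n : Multiplicative ℕ) (a : F) : n • a = a ^ 2 ^ n.toAdd := rfl

/-- The commutation rule of the skew polynomial ring. -/
theorem X_mul_C (α : F) : (SkewPolynomial.X : SkewPolynomial F) * SkewPolynomial.C α =
    SkewPolynomial.C (α ^ 2) * SkewPolynomial.X := by
  rw [← SkewPolynomial.monomial_one_one_eq_X, SkewPolynomial.monomial_mul_C,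
    SkewPolynomial.C_mul_monomial]
  simp only [Function.iterate_one, one_mul, mul_one]
  rfl

/-- The two-sided ideal `(X⁵)`. -/
def idealX5 : TwoSidedIdeal (SkewPolynomial F) :=
  TwoSidedIdeal.span {SkewPolynomial.X ^ 5}

/-- The ring `R = F{X}/(X⁵)`. -/
abbrev R : Type := idealX5.ringCon.Quotient

/-- The embedding of `F` into `R` as constants. -/
def constR : F →+* R := idealX5.ringCon.mk'.comp SkewPolynomial.CRingHom

/-- The image of `X` in `R`. -/
def x : R := idealX5.ringCon.mk' SkewPolynomial.X

/-! ### The coordinatewise action of the Galois group -/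

/-- `σ` applied to the coefficients of a skew polynomial. -/
def skewMap (σ : Gal8) : SkewPolynomial F →+* SkewPolynomial F :=
  SkewMonoidAlgebra.liftNCRingHom
    ((SkewPolynomial.CRingHom : F →+* SkewPolynomial F).comp (σ : F →+* F))
    (SkewMonoidAlgebra.of F (Multiplicative ℕ)) (by
      intro a n
      change SkewMonoidAlgebra.single 1 (σ (n • a)) * SkewMonoidAlgebra.single n 1 =
        SkewMonoidAlgebra.single n 1 * SkewMonoidAlgebra.single 1 (σ a)
      rw [SkewMonoidAlgebra.single_mul_single, SkewMonoidAlgebra.single_mul_single]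
      simp [frobeniusAction_apply])

theorem skewMap_monomial (σ : Gal8) (n : ℕ) (a : F) :
    skewMap σ (SkewPolynomial.monomial n a) = SkewPolynomial.monomial n (σ a) := by
  change SkewMonoidAlgebra.liftNC _ _ (SkewMonoidAlgebra.single _ a) = _
  rw [SkewMonoidAlgebra.liftNC_single]
  change SkewMonoidAlgebra.single 1 (σ a) * SkewMonoidAlgebra.single _ 1 =
    SkewMonoidAlgebra.single _ (σ a)
  rw [SkewMonoidAlgebra.single_mul_single]
  simp

theorem idealX5_le_ker (σ : Gal8) :
    idealX5.ringCon ≤ RingCon.ker (idealX5.ringCon.mk'.comp (skewMap σ)) := by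
  have h : idealX5 ≤ TwoSidedIdeal.ker (idealX5.ringCon.mk'.comp (skewMap σ)) := by
    refine TwoSidedIdeal.span_le.2 ?_
    rintro _ rfl
    rw [SetLike.mem_coe, TwoSidedIdeal.mem_ker, RingHom.comp_apply,
      ← SkewPolynomial.monomial_one_right_eq_X_pow, skewMap_monomial, map_one,
      SkewPolynomial.monomial_one_right_eq_X_pow]
    exact (RingCon.eq _).2 (TwoSidedIdeal.subset_span (Set.mem_singleton _))
  intro p q hpq
  have h2 := h ((TwoSidedIdeal.rel_iff _ _ _).1 hpq)
  rw [TwoSidedIdeal.mem_ker, map_sub, sub_eq_zero] at h2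
  exact h2

/-- The ring endomorphism of `R` applying `σ` to the coefficients. -/
def galHom (σ : Gal8) : R →+* R :=
  idealX5.ringCon.lift (idealX5.ringCon.mk'.comp (skewMap σ)) (idealX5_le_ker σ)

theorem galHom_mk (σ : Gal8) (p : SkewPolynomial F) :
    galHom σ (idealX5.ringCon.mk' p) = idealX5.ringCon.mk' (skewMap σ p) := rfl

theorem skewMap_one (p : SkewPolynomial F) : skewMap 1 p = p := by
  induction p using SkewPolynomial.induction with
  | h0 => exact map_zero _
  | ha n r q _ _ ih => rw [map_add, ih, skewMap_monomial]; rfl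

theorem skewMap_mul (σ τ : Gal8) (p : SkewPolynomial F) :
    skewMap (σ * τ) p = skewMap σ (skewMap τ p) := by
  induction p using SkewPolynomial.induction with
  | h0 => simp only [map_zero]
  | ha n r q _ _ ih =>
    rw [map_add, map_add, map_add, ih, skewMap_monomial, skewMap_monomial, skewMap_monomial]; rfl

theorem galHom_one (r : R) : galHom 1 r = r := by
  obtain ⟨p, rfl⟩ := idealX5.ringCon.mk'_surjective r
  rw [galHom_mk, skewMap_one]

theorem galHom_mul (σ τ : Gal8) (r : R) : galHom (σ * τ) r = galHom σ (galHom τ r) := by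
  obtain ⟨p, rfl⟩ := idealX5.ringCon.mk'_surjective r
  rw [galHom_mk, galHom_mk, galHom_mk, skewMap_mul]

theorem galHom_x (σ : Gal8) : galHom σ x = x := by
  rw [x, galHom_mk, ← SkewPolynomial.monomial_one_one_eq_X, skewMap_monomial, map_one]

theorem galHom_constR (σ : Gal8) (a : F) : galHom σ (constR a) = constR (σ a) :=
  congrArg idealX5.ringCon.mk' (skewMap_monomial σ 0 a)

/-- The Galois group acts on the units of `R` coordinatewise. -/
def galUnits : Gal8 →* MulAut Rˣ where
  toFun σ :=
    { toFun := Units.map (galHom σ : R →* R)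
      invFun := Units.map (galHom σ⁻¹ : R →* R)
      left_inv := fun u => Units.ext (by
        change galHom σ⁻¹ (galHom σ (u : R)) = u
        rw [← galHom_mul, inv_mul_cancel, galHom_one])
      right_inv := fun u => Units.ext (by
        change galHom σ (galHom σ⁻¹ (u : R)) = u
        rw [← galHom_mul, mul_inv_cancel, galHom_one])
      map_mul' := map_mul _ }
  map_one' := MulEquiv.ext fun u => Units.ext (galHom_one u)
  map_mul' σ τ := MulEquiv.ext fun u => Units.ext (galHom_mul σ τ u)

/-! ### The groups `C𝒢`, `Q`, `P` and `G` -/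

/-- The semidirect product `C𝒢` of `C = Fˣ` by the Galois group, with its natural action. -/
abbrev CG : Type := Fˣ ⋊[MulDistribMulAction.toMulAut Gal8 Fˣ] Gal8

/-- The action of `C𝒢` on the units of `R`: `C` acts by conjugation with constants, and the
Galois group acts coordinatewise. -/
def actCG : CG →* MulAut Rˣ :=
  SemidirectProduct.lift
    (MulAut.conj.comp (Units.map (constR : F →* R)))
    galUnits (by
      intro σ
      ext c u
      change (constR (σ c) * (u : R) * constR ((σ • c)⁻¹ : Fˣ) : R) =
        galHom σ (constR c * galHom σ⁻¹ (u : R) * constR (c⁻¹ : Fˣ))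
      rw [map_mul, map_mul, galHom_constR, galHom_constR, ← galHom_mul, mul_inv_cancel,
        galHom_one]
      rfl)

/-- The subgroup `Q = 1 + J(R)` of the group of units of `R`. -/
def Q : Subgroup Rˣ where
  carrier := {u | (u : R) - 1 ∈ Ring.jacobson R}
  one_mem' := by simp
  mul_mem' := by
    intro u v hu hv
    have h : ((u * v : Rˣ) : R) - 1 = u * ((v : R) - 1) + ((u : R) - 1) := by
      rw [Units.val_mul]; noncomm_ring
    change ((u * v : Rˣ) : R) - 1 ∈ Ring.jacobson R
    rw [h]
    exact add_mem (Ideal.mul_mem_left _ _ hv) hu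
  inv_mem' := by
    intro u hu
    have h : ((u⁻¹ : Rˣ) : R) - 1 = -(((u⁻¹ : Rˣ) : R) * ((u : R) - 1)) := by
      rw [mul_sub, Units.inv_mul]; noncomm_ring
    change ((u⁻¹ : Rˣ) : R) - 1 ∈ Ring.jacobson R
    rw [h]
    exact neg_mem (Ideal.mul_mem_left _ _ hu)

/-- A subgroup of the units of `R` is invariant under `C𝒢`. -/
def IsInvariant (P : Subgroup Rˣ) : Prop := ∀ h : CG, ∀ u ∈ P, actCG h u ∈ P

/-- `P` is a subgroup of index 2 in `Q` that is invariant under `C𝒢`. -/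
structure IsInvariantIndexTwo (P : Subgroup Rˣ) : Prop where
  le : P ≤ Q
  index : P.relIndex Q = 2
  invariant : IsInvariant P

/-- The action of `C𝒢` on an invariant subgroup. -/
def actOn (P : Subgroup Rˣ) (hP : IsInvariant P) : CG →* MulAut P where
  toFun h :=
    { toFun := fun u => ⟨actCG h u, hP h u u.2⟩
      invFun := fun u => ⟨actCG h⁻¹ u, hP h⁻¹ u u.2⟩
      left_inv := fun u => Subtype.ext (by
        change actCG h⁻¹ (actCG h (u : Rˣ)) = u
        rw [map_inv]; exact (actCG h).symm_apply_apply _)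
      right_inv := fun u => Subtype.ext (by
        change actCG h (actCG h⁻¹ (u : Rˣ)) = u
        rw [map_inv]; exact (actCG h).apply_symm_apply _)
      map_mul' := fun u v => Subtype.ext (map_mul (actCG h) _ _) }
  map_one' := MulEquiv.ext fun u => Subtype.ext (by
    change actCG 1 (u : Rˣ) = u
    rw [map_one]; rfl)
  map_mul' h k := MulEquiv.ext fun u => Subtype.ext (by
    change actCG (h * k) (u : Rˣ) = actCG h (actCG k u)
    rw [map_mul]; rfl)

/-- The semidirect product `G = P ⋊ C𝒢`. -/
abbrev G (P : Subgroup Rˣ) (hP : IsInvariant P) : Type := P ⋊[actOn P hP] CG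

/-- The list of possible Sylow 2-subgroups in the theorem of Moretó and Navarro, with the word
"iterated" removed: `S` is cyclic, or it is normal and it is homocyclic, quaternion of order 8,
or a central extension of a Suzuki 2-group. -/
def IsInListWithoutIterated {Γ : Type*} [Group Γ] (S : Subgroup Γ) : Prop :=
  IsCyclic S ∨ (S.Normal ∧ (IsHomocyclic S ∨ Nonempty (S ≃* QuaternionGroup 2) ∨
    IsCentralExtensionOfSuzuki S))

end

end ThreeReal

namespace ThreeReal

noncomputable section

/-! ### Irreducible characters and conjugacy classes -/

section Characters

open Module Matrix ComplexOrder

/-! Everything is read off from coordinates: an element of `Q` is `1 + a x + b x² + c x³ + d x⁴`,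
multiplied by the polynomial formulas of `qu_mul_qu`. A constant `t` scales the coefficient of `xⁿ`
by `t ^ (1 - 2 ^ n)`, hence by `t⁻¹, t⁻³, 1, t⁻¹` for `n = 1, 2, 3, 4`, because `t ^ 7 = 1`. An
invariant homomorphism from `Q` to a group of order two must vanish on the three layers where `C`
acts by nontrivial scalars. On the cubic layer it is a Galois-invariant functional, so zero or the
trace. The trace does extend to `Q`, as `tr (c + a⁴ b + a⁷)` (`tr_lam_mul`), so its kernel `P` is
the only candidate (`IsInvariantIndexTwo.eq_traceSubgroup`).

Real-valued irreducible characters are as many as real classes (`ncard_realIrrChars`): the trace of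
inversion on class functions is computed in two bases. As `C𝒢` has odd order, a real element of `G`
lies in `P` and is inverted by an element of `P`. Trace arguments, resting on `tr 1 = 1`, then force
`a = b = 0` (`leading_coeffs_of_semiconjBy_inv`). The remaining elements `1 + c x³ + d x⁴` with `tr
c = 0` have square one and form three classes (`ncard_realClasses`): the identity, the nontrivial
central elements, fused by `C`, and those with `c ≠ 0`, fused by `𝒢` and by conjugation in `P`.

The centre of `P` is `a = b = c = 0` and the second centre is `a = b = 0`, so `P / Z₂(P)` is the
group of pairs `(a, b)` with cocycle `a a'²`, which is of type A. No quotient of `P` by a central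
subgroup is a Suzuki 2-group, since involutions of a Suzuki 2-group are central
(`not_isCentralExtensionOfSuzuki_traceSubgroup`). -/

theorem character_inv_eq_conj {Γ V : Type*} [Group Γ] [Finite Γ] [AddCommGroup V] [Module ℂ V]
    [FiniteDimensional ℂ V] (ρ : Representation ℂ Γ V) (g : Γ) :
    ρ.character g⁻¹ = starRingEnd ℂ (ρ.character g) := by
  classical
  have := Fintype.ofFinite Γ
  let b := Module.finBasis ℂ V
  let A : Γ → Matrix (Fin (finrank ℂ V)) (Fin (finrank ℂ V)) ℂ :=
    fun h => LinearMap.toMatrix b b (ρ h)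
  have hA (h k : Γ) : A (h * k) = A h * A k := by
    simp only [A, map_mul, LinearMap.toMatrix_mul]
  have hA1 : A 1 = 1 := by simp only [A, map_one, LinearMap.toMatrix_one]
  have htr (h : Γ) : ρ.character h = (A h).trace :=
    LinearMap.trace_eq_matrix_trace ℂ b (ρ h)
  -- Gram matrix of an invariant inner product. Its invariance makes `A g⁻¹` similar to the
  -- conjugate transpose of `A g`.
  let H := ∑ h : Γ, (A h)ᴴ * A h
  have hH : H.PosDef := by
    have h1 : H = 1 + ∑ h ∈ Finset.univ.erase (1 : Γ), (A h)ᴴ * A h := by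
      rw [show H = ∑ h : Γ, (A h)ᴴ * A h from rfl,
        ← Finset.add_sum_erase _ _ (Finset.mem_univ (1 : Γ)), hA1]
      simp
    rw [h1]
    exact PosDef.one.add_posSemidef
      (posSemidef_sum _ fun h _ => posSemidef_conjTranspose_mul_self (A h))
  have hinv : (A g)ᴴ * H * A g = H := by
    simp only [H, Finset.mul_sum, Finset.sum_mul]
    refine Fintype.sum_equiv (Equiv.mulRight g) _ _ fun h => ?_
    rw [Equiv.coe_mulRight, hA, conjTranspose_mul]
    simp only [Matrix.mul_assoc]
  have hu : IsUnit H.det := (isUnit_iff_isUnit_det H).1 hH.isUnit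
  have hgg : A g * A g⁻¹ = 1 := by rw [← hA, mul_inv_cancel, hA1]
  have key : A g⁻¹ = H⁻¹ * ((A g)ᴴ * H) := by
    have h2 : (A g)ᴴ * H = H * A g⁻¹ := by
      calc (A g)ᴴ * H = (A g)ᴴ * H * (A g * A g⁻¹) := by rw [hgg, Matrix.mul_one]
        _ = H * A g⁻¹ := by rw [← Matrix.mul_assoc, hinv]
    rw [h2, ← Matrix.mul_assoc, nonsing_inv_mul _ hu, Matrix.one_mul]
  rw [htr, htr, key, trace_mul_comm, Matrix.mul_assoc, mul_nonsing_inv _ hu, Matrix.mul_one,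
    trace_conjTranspose]
  rfl

/-- The common kernel of an invariant space of functionals is invariant in `V`, and in finite
dimension it determines that space. -/
theorem isIrreducible_dual {Γ V k : Type*} [Group Γ] [Field k] [AddCommGroup V] [Module k V]
    [FiniteDimensional k V] (ρ : Representation k Γ V) [hρ : ρ.IsIrreducible] :
    ρ.dual.IsIrreducible := by
  have hV : Nontrivial V := by
    by_contra hV
    rw [not_nontrivial_iff_subsingleton] at hV
    obtain ⟨W, W', hW⟩ := hρ.toNontrivial
    refine hW (Subrepresentation.toSubmodule_injective ?_)
    exact Subsingleton.elim _ _
  have key (W : Subrepresentation ρ.dual) :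
      W.toSubmodule = ⊥ ∨ W.toSubmodule = ⊤ := by
    let U : Subrepresentation ρ :=
      { toSubmodule := W.toSubmodule.dualCoannihilator
        apply_mem_toSubmodule := fun g v hv => by
          rw [Submodule.mem_dualCoannihilator] at hv ⊢
          intro φ hφ
          have := hv _ (W.apply_mem_toSubmodule g⁻¹ hφ)
          simpa [Representation.dual_apply, Module.Dual.transpose_apply] using this }
    have hU : U.toSubmodule = W.toSubmodule.dualCoannihilator := rfl
    rcases hρ.eq_bot_or_eq_top U with h | h
    · right
      rw [← Subspace.dualCoannihilator_dualAnnihilator_eq (W := W.toSubmodule), ← hU, h]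
      exact Submodule.dualAnnihilator_bot
    · left
      rw [← Subspace.dualCoannihilator_dualAnnihilator_eq (W := W.toSubmodule), ← hU, h]
      exact Submodule.dualAnnihilator_top
  refine { exists_pair_ne := ⟨⊥, ⊤, fun h => ?_⟩, eq_bot_or_eq_top := fun W => ?_ }
  · have := congrArg Subrepresentation.toSubmodule h
    exact bot_ne_top (α := Submodule k (Dual k V)) this
  · exact (key W).imp (fun h => Subrepresentation.toSubmodule_injective h)
      (fun h => Subrepresentation.toSubmodule_injective h)

/-- A class function orthogonal to all irreducible characters acts as zero on every irreducible
representation. -/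
theorem sum_smul_eq_zero {Γ V : Type*} [Group Γ] [Fintype Γ] [AddCommGroup V] [Module ℂ V]
    [FiniteDimensional ℂ V] (ρ : Representation ℂ Γ V) [hρ : ρ.IsIrreducible] (f : Γ → ℂ)
    (hf : ∀ g h, f (h * g * h⁻¹) = f g) (h0 : ∑ g, f g * ρ.character g = 0) :
    ∑ g, f g • ρ g = 0 := by
  have hV : Nontrivial V := by
    by_contra hV
    rw [not_nontrivial_iff_subsingleton] at hV
    obtain ⟨W, W', hW⟩ := hρ.toNontrivial
    refine hW (Subrepresentation.toSubmodule_injective ?_)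
    exact Subsingleton.elim _ _
  -- By Schur's lemma this intertwiner is a scalar `c`; its trace `c · dim V` is zero by `h0`.
  let A : Representation.IntertwiningMap ρ ρ :=
    { toLinearMap := ∑ g, f g • ρ g
      isIntertwining' := fun h => by
        change (∑ g, f g • ρ g) * ρ h = ρ h * (∑ g, f g • ρ g)
        rw [Finset.sum_mul, Finset.mul_sum]
        refine Fintype.sum_equiv (MulAut.conj h⁻¹).toEquiv _ _ fun g => ?_
        have : f ((MulAut.conj h⁻¹).toEquiv g) = f g := hf g h⁻¹
        rw [this, smul_mul_assoc, mul_smul_comm, ← map_mul, ← map_mul]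
        congr 2
        simp [mul_assoc] }
  obtain ⟨c, hc⟩ :=
    (Representation.IsIrreducible.algebraMap_intertwiningMap_bijective_of_isAlgClosed (ρ := ρ)).2 A
  have hA : (∑ g, f g • ρ g) = c • (1 : V →ₗ[ℂ] V) := by
    have := congrArg Representation.IntertwiningMap.toLinearMap hc
    change _ = (∑ g, f g • ρ g) at this
    rw [← this]
    rfl
  have htr := congrArg (LinearMap.trace ℂ V) hA
  rw [map_sum, map_smul, LinearMap.trace_one] at htr
  simp only [map_smul, smul_eq_mul] at htr
  change ∑ g, f g * ρ.character g = _ at htr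
  rw [h0] at htr
  have hfr : (finrank ℂ V : ℂ) ≠ 0 := by exact_mod_cast finrank_pos.ne'
  have : c = 0 := by
    rcases mul_eq_zero.1 htr.symm with h | h
    · exact h
    · exact absurd h hfr
  rw [hA, this, zero_smul]

/-- The set of irreducible complex characters. -/
def irrChars (Γ : Type) [Group Γ] : Set (Γ → ℂ) :=
  {χ | ∃ (V : Type) (_ : AddCommGroup V) (_ : Module ℂ V) (_ : FiniteDimensional ℂ V)
        (ρ : Representation ℂ Γ V), ρ.IsIrreducible ∧ ρ.character = χ}

open scoped MonoidAlgebra in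
theorem sum_single_smul_eq_zero {Γ M : Type} [Group Γ] [Fintype Γ] [AddCommGroup M]
    [Module ℂ[Γ] M] [hs : IsSimpleModule ℂ[Γ] M] (f : Γ → ℂ)
    (hf : ∀ g h, f (h * g * h⁻¹) = f g) (h0 : ∀ χ ∈ irrChars Γ, ∑ g, f g * χ g = 0) (v : M) :
    (∑ g, MonoidAlgebra.single g (f g) : ℂ[Γ]) • v = 0 := by
  let : Module ℂ M := Module.compHom M (algebraMap ℂ ℂ[Γ])
  have : IsScalarTower ℂ ℂ[Γ] M := IsScalarTower.of_algebraMap_smul fun _ _ => rfl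
  let ρ : Representation ℂ Γ M := Representation.ofModule' M
  have hact (g : Γ) (w : M) : ρ g w = (MonoidAlgebra.single g 1 : ℂ[Γ]) • w := rfl
  have hsingle (g : Γ) (c : ℂ) (w : M) :
      (MonoidAlgebra.single g c : ℂ[Γ]) • w = c • ρ g w := by
    rw [hact, ← smul_assoc, MonoidAlgebra.smul_single, smul_eq_mul, mul_one]
  have key (W : Subrepresentation ρ) : W.toSubmodule = ⊥ ∨ W.toSubmodule = ⊤ := by
    let N : Submodule ℂ[Γ] M :=
      { W.toSubmodule with
        smul_mem' := fun a w hw => by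
          induction a using MonoidAlgebra.induction_linear with
          | zero => rw [zero_smul]; exact W.toSubmodule.zero_mem
          | add a b ha hb => rw [add_smul]; exact W.toSubmodule.add_mem ha hb
          | single g c =>
            rw [hsingle]
            exact W.toSubmodule.smul_mem c (W.apply_mem_toSubmodule g hw) }
    have hN (w : M) : w ∈ N ↔ w ∈ W.toSubmodule := Iff.rfl
    rcases eq_bot_or_eq_top N with h | h
    · left; ext w; rw [← hN, h]; simp
    · right; ext w; rw [← hN, h]; simp
  have hρ : ρ.IsIrreducible := by
    refine { exists_pair_ne := ⟨⊥, ⊤, fun h => ?_⟩, eq_bot_or_eq_top := fun W => ?_ }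
    · have := congrArg Subrepresentation.toSubmodule h
      have hn := IsSimpleModule.nontrivial ℂ[Γ] M
      exact bot_ne_top (α := Submodule ℂ M) this
    · exact (key W).imp (fun h => Subrepresentation.toSubmodule_injective h)
        (fun h => Subrepresentation.toSubmodule_injective h)
  have hfin : FiniteDimensional ℂ M := Module.Finite.trans ℂ[Γ] _
  have h1 := sum_smul_eq_zero ρ f hf (h0 _ ⟨_, _, _, hfin, ρ, hρ, rfl⟩)
  have h2 := LinearMap.congr_fun h1 v
  rw [LinearMap.zero_apply, LinearMap.sum_apply] at h2
  rw [← h2, Finset.sum_smul]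
  exact Finset.sum_congr rfl fun g _ => hsingle g _ v

-- The element of the group algebra with coefficients `f` kills `ℂ[Γ] ⧸ m` for every maximal left
-- ideal `m`, so it lies in the Jacobson radical, which is zero by Maschke's theorem.
open scoped MonoidAlgebra in
theorem eq_zero_of_orthogonal_irrChars {Γ : Type} [Group Γ] [Fintype Γ] (f : Γ → ℂ)
    (hf : ∀ g h, f (h * g * h⁻¹) = f g) (h0 : ∀ χ ∈ irrChars Γ, ∑ g, f g * χ g = 0) : f = 0 := by
  classical
  let e : ℂ[Γ] := ∑ g, MonoidAlgebra.single g (f g)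
  have : NeZero (Nat.card Γ : ℂ) := ⟨by exact_mod_cast Nat.card_pos.ne'⟩
  have he : e ∈ Ring.jacobson ℂ[Γ] := by
    change e ∈ Module.jacobson _ _
    rw [Module.jacobson, Submodule.mem_sInf]
    intro m hm
    have hs : IsSimpleModule ℂ[Γ] (ℂ[Γ] ⧸ m) := isSimpleModule_iff_isCoatom.2 hm
    have h3 := sum_single_smul_eq_zero f hf h0 (Submodule.Quotient.mk (p := m) 1)
    rw [← Submodule.Quotient.mk_smul, Submodule.Quotient.mk_eq_zero, smul_eq_mul, mul_one] at h3
    exact h3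
  rw [IsSemisimpleRing.jacobson_eq_bot, Submodule.mem_bot] at he
  funext g
  have := congrArg (fun p : ℂ[Γ] => p.coeff g) he
  simpa [e, Finsupp.finsetSum_apply, Finsupp.single_apply] using this

variable {Γ : Type} [Group Γ]

theorem irrChars_conj {χ : Γ → ℂ} (h : χ ∈ irrChars Γ) (g k : Γ) : χ (k * g * k⁻¹) = χ g := by
  obtain ⟨V, _, _, _, ρ, _, rfl⟩ := h
  exact ρ.char_conj g k

theorem irrChars_isConj {χ : Γ → ℂ} (h : χ ∈ irrChars Γ) {g k : Γ} (hgk : IsConj g k) :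
    χ g = χ k := by
  obtain ⟨c, rfl⟩ := isConj_iff.1 hgk
  exact (irrChars_conj h g c).symm

theorem irrChars_inv {χ : Γ → ℂ} (h : χ ∈ irrChars Γ) : (fun g => χ g⁻¹) ∈ irrChars Γ := by
  obtain ⟨V, _, _, _, ρ, _, rfl⟩ := h
  exact ⟨Dual ℂ V, _, _, inferInstance, ρ.dual, isIrreducible_dual ρ,
    funext fun g => ρ.char_dual g⟩

theorem irrChars_inv_eq_conj [Finite Γ] {χ : Γ → ℂ} (h : χ ∈ irrChars Γ) (g : Γ) :
    χ g⁻¹ = starRingEnd ℂ (χ g) := by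
  obtain ⟨V, _, _, _, ρ, _, rfl⟩ := h
  exact character_inv_eq_conj ρ g

theorem irrChars_orthogonal [Fintype Γ] {χ ψ : Γ → ℂ} (hχ : χ ∈ irrChars Γ) (hψ : ψ ∈ irrChars Γ)
    (h : χ ≠ ψ) : ∑ g, χ g * ψ g⁻¹ = 0 := by
  obtain ⟨V, _, _, _, ρ, hρ, rfl⟩ := hχ
  obtain ⟨W, _, _, _, σ, hσ, rfl⟩ := hψ
  have hc : (Nat.card Γ : ℂ) ≠ 0 := by exact_mod_cast Nat.card_pos.ne'
  have : Invertible (Nat.card Γ : ℂ) := invertibleOfNonzero hc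
  have h1 := Representation.char_orthonormal ρ σ
  rw [if_neg fun ⟨e⟩ => h (Representation.char_iso e).symm] at h1
  exact (mul_eq_zero.1 h1).resolve_left (inv_ne_zero hc)

theorem irrChars_norm [Fintype Γ] {χ : Γ → ℂ} (hχ : χ ∈ irrChars Γ) :
    ∑ g, χ g * χ g⁻¹ = Nat.card Γ := by
  obtain ⟨V, _, _, _, ρ, hρ, rfl⟩ := hχ
  have hc : (Nat.card Γ : ℂ) ≠ 0 := by exact_mod_cast Nat.card_pos.ne'
  have : Invertible (Nat.card Γ : ℂ) := invertibleOfNonzero hc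
  have h1 := Representation.char_orthonormal ρ ρ
  rw [if_pos ⟨Representation.Equiv.refl ρ⟩, inv_mul_eq_iff_eq_mul₀ hc, mul_one] at h1
  exact h1

/-- A class function, viewed as a function on conjugacy classes. -/
def onClasses (f : Γ → ℂ) : ConjClasses Γ → ℂ := fun k => f (Quotient.out k)

theorem onClasses_mk {χ : Γ → ℂ} (hχ : χ ∈ irrChars Γ) (g : Γ) :
    onClasses χ (ConjClasses.mk g) = χ g :=
  irrChars_isConj hχ (ConjClasses.mk_eq_mk_iff_isConj.1 (Quotient.out_eq (ConjClasses.mk g)))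

/-- Inversion of conjugacy classes. -/
def invClass : ConjClasses Γ → ConjClasses Γ :=
  Quotient.map (·⁻¹) fun a b h => by
    obtain ⟨c, rfl⟩ := isConj_iff.1 h
    exact isConj_iff.2 ⟨c, by group⟩

theorem invClass_mk (g : Γ) : invClass (ConjClasses.mk g) = ConjClasses.mk g⁻¹ := rfl

theorem linearIndependent_onClasses [Fintype Γ] :
    LinearIndependent ℂ (fun χ : irrChars Γ => onClasses χ.1) := by
  rw [linearIndependent_iff']
  intro s a h ψ hψ
  have h1 (g : Γ) : ∑ χ ∈ s, a χ * χ.1 g = 0 := by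
    have := congrFun h (ConjClasses.mk g)
    rw [Finset.sum_apply] at this
    rw [← Pi.zero_apply (M := fun _ => ℂ) (ConjClasses.mk g), ← this]
    refine Finset.sum_congr rfl fun χ _ => ?_
    rw [Pi.smul_apply, onClasses_mk χ.2, smul_eq_mul]
  have h2 : ∑ χ ∈ s, a χ * ∑ g, χ.1 g * ψ.1 g⁻¹ = 0 := by
    simp only [Finset.mul_sum]
    rw [Finset.sum_comm]
    refine Finset.sum_eq_zero fun g _ => ?_
    simp only [← mul_assoc]
    rw [← Finset.sum_mul, h1, zero_mul]
  rw [Finset.sum_eq_single ψ (fun χ _ hne => by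
    rw [irrChars_orthogonal χ.2 ψ.2 fun h => hne (Subtype.ext h), mul_zero])
    (fun h => absurd hψ h), irrChars_norm ψ.2] at h2
  exact (mul_eq_zero.1 h2).resolve_right (by exact_mod_cast Nat.card_pos.ne')

theorem span_onClasses [Fintype Γ] :
    Submodule.span ℂ (Set.range fun χ : irrChars Γ => onClasses χ.1) = ⊤ := by
  classical
  have : Finite (irrChars Γ) := linearIndependent_onClasses.finite
  have := Fintype.ofFinite (irrChars Γ)
  have hc : (Nat.card Γ : ℂ) ≠ 0 := by exact_mod_cast Nat.card_pos.ne'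
  rw [eq_top_iff]
  intro F _
  let a : irrChars Γ → ℂ := fun χ => (Nat.card Γ : ℂ)⁻¹ * ∑ g, F (ConjClasses.mk g) * χ.1 g⁻¹
  -- `F` minus its projection to the span of the characters, taken at `g⁻¹` because
  -- `eq_zero_of_orthogonal_irrChars` pairs `f g` with `χ g`, without conjugation.
  let f : Γ → ℂ := fun g => F (ConjClasses.mk g⁻¹) - ∑ χ, a χ * χ.1 g⁻¹
  have hf : f = 0 := by
    refine eq_zero_of_orthogonal_irrChars f (fun g h => ?_) fun ψ hψ => ?_
    · have h1 : ConjClasses.mk (h * g * h⁻¹)⁻¹ = ConjClasses.mk g⁻¹ :=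
        ConjClasses.mk_eq_mk_iff_isConj.2 (isConj_iff.2 ⟨h⁻¹, by group⟩)
      simp only [f]
      rw [h1]
      congr 1
      refine Finset.sum_congr rfl fun χ _ => ?_
      rw [show (h * g * h⁻¹)⁻¹ = h * g⁻¹ * h⁻¹ by group, irrChars_conj χ.2]
    · simp only [f, sub_mul, Finset.sum_sub_distrib, Finset.sum_mul]
      rw [Finset.sum_comm, Finset.sum_eq_single (⟨ψ, hψ⟩ : irrChars Γ)]
      · simp only [a, mul_assoc]
        rw [← Finset.mul_sum, ← Finset.mul_sum,
          show ∑ g, ψ g⁻¹ * ψ g = Nat.card Γ by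
            rw [← irrChars_norm hψ]; exact Finset.sum_congr rfl fun g _ => mul_comm _ _,
          mul_comm _ (Nat.card Γ : ℂ), inv_mul_cancel_left₀ hc, sub_eq_zero]
        exact Fintype.sum_equiv (Equiv.inv Γ) _ _ fun g => by simp
      · intro χ _ hne
        simp only [mul_assoc]
        rw [← Finset.mul_sum, show ∑ g, χ.1 g⁻¹ * ψ g = ∑ g, ψ g * χ.1 g⁻¹ from
          Finset.sum_congr rfl fun g _ => mul_comm _ _,
          irrChars_orthogonal hψ χ.2 fun h => hne (Subtype.ext h.symm), mul_zero]
      · exact fun h => absurd (Finset.mem_univ _) h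
  have hF : F = ∑ χ, a χ • onClasses χ.1 := by
    funext k
    obtain ⟨g, rfl⟩ := ConjClasses.mk_surjective k
    have := congrFun hf g⁻¹
    simp only [f, inv_inv, Pi.zero_apply, sub_eq_zero] at this
    rw [this, Finset.sum_apply]
    refine Finset.sum_congr rfl fun χ _ => ?_
    rw [Pi.smul_apply, onClasses_mk χ.2, smul_eq_mul]
  rw [hF]
  exact Submodule.sum_mem _ fun χ _ => Submodule.smul_mem _ _ (Submodule.subset_span ⟨χ, rfl⟩)

theorem im_eq_zero_iff_inv [Finite Γ] {χ : Γ → ℂ} (hχ : χ ∈ irrChars Γ) :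
    (∀ g, (χ g).im = 0) ↔ (fun g => χ g⁻¹) = χ := by
  rw [funext_iff]
  refine forall_congr' fun g => ?_
  rw [irrChars_inv_eq_conj hχ, Complex.conj_eq_iff_im]

/-- A finite group has as many real-valued irreducible complex characters as conjugacy classes of
elements conjugate to their inverses. -/
theorem ncard_realIrrChars [Finite Γ] :
    (realIrrChars Γ).ncard = {k : ConjClasses Γ | invClass k = k}.ncard := by
  classical
  have := Fintype.ofFinite Γ
  have : Finite (irrChars Γ) := linearIndependent_onClasses.finite
  have := Fintype.ofFinite (irrChars Γ)
  have := Fintype.ofFinite (ConjClasses Γ)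
  -- The trace of `T` in the standard basis counts the classes fixed by inversion. In the basis of
  -- irreducible characters, which `T` permutes by complex conjugation, it counts the real-valued
  -- ones.
  let T : (ConjClasses Γ → ℂ) →ₗ[ℂ] (ConjClasses Γ → ℂ) := LinearMap.funLeft ℂ ℂ invClass
  have h1 : LinearMap.trace ℂ _ T = {k : ConjClasses Γ | invClass k = k}.ncard := by
    rw [LinearMap.trace_eq_matrix_trace ℂ (Pi.basisFun ℂ (ConjClasses Γ)), Matrix.trace,
      Set.ncard_eq_toFinset_card', Set.toFinset_ofPred, Finset.card_filter, Nat.cast_sum]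
    refine Finset.sum_congr rfl fun k _ => ?_
    rw [Matrix.diag_apply, LinearMap.toMatrix_apply]
    simp only [Pi.basisFun_apply, Pi.basisFun_repr, T, LinearMap.funLeft_apply, Pi.single_apply]
    split_ifs <;> simp
  let B : Basis (irrChars Γ) ℂ (ConjClasses Γ → ℂ) :=
    Basis.mk linearIndependent_onClasses span_onClasses.ge
  have hT (χ : irrChars Γ) : T (B χ) = B ⟨_, irrChars_inv χ.2⟩ := by
    simp only [B, Basis.mk_apply]
    funext k
    obtain ⟨g, rfl⟩ := ConjClasses.mk_surjective k
    rw [LinearMap.funLeft_apply, invClass_mk, onClasses_mk χ.2, onClasses_mk (irrChars_inv χ.2)]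
  have h2 : LinearMap.trace ℂ _ T = (realIrrChars Γ).ncard := by
    have h3 : realIrrChars Γ = Subtype.val '' {χ : irrChars Γ | (fun g => χ.1 g⁻¹) = χ.1} := by
      ext χ
      constructor
      · rintro ⟨h, h'⟩
        exact ⟨⟨χ, h⟩, (im_eq_zero_iff_inv h).1 h', rfl⟩
      · rintro ⟨⟨χ, h⟩, h', rfl⟩
        exact ⟨h, (im_eq_zero_iff_inv h).2 h'⟩
    rw [h3, Set.ncard_image_of_injective _ Subtype.val_injective,
      LinearMap.trace_eq_matrix_trace ℂ B, Matrix.trace,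
      Set.ncard_eq_toFinset_card', Set.toFinset_ofPred, Finset.card_filter, Nat.cast_sum]
    refine Finset.sum_congr rfl fun χ _ => ?_
    rw [Matrix.diag_apply, LinearMap.toMatrix_apply, hT, Basis.repr_self, Finsupp.single_apply]
    simp only [Subtype.ext_iff]
    split_ifs <;> simp
  exact_mod_cast h2.symm.trans h1

end Characters

/-! ### Coordinates on the ring `R` -/

section RingCoordinates

open SkewPolynomial Finset.HasAntidiagonal

theorem coeff_mul (p q : SkewPolynomial F) (n : ℕ) :
    (p * q).coeff n = ∑ ij ∈ antidiagonal n, p.coeff ij.1 * q.coeff ij.2 ^ 2 ^ ij.1 := by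
  induction p using SkewPolynomial.induction with
  | h0 => simp
  | ha i r p _ _ ih =>
    rw [add_mul, coeff_add, ih]
    simp only [coeff_add, add_mul, Finset.sum_add_distrib, add_left_inj]
    clear ih
    induction q using SkewPolynomial.induction with
    | h0 => simp
    | ha j s q _ _ ih =>
      rw [mul_add, coeff_add, ih]
      simp only [coeff_add, add_pow_char_pow, mul_add, Finset.sum_add_distrib, add_left_inj]
      rw [monomial_mul_monomial, φ_iterate_apply, frobeniusAction_apply, toAdd_ofAdd,
        coeff_monomial]
      split_ifs with h
      · rw [Finset.sum_eq_single (i, j)]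
        · simp [coeff_monomial]
        · rintro ⟨a, b⟩ hab hne
          rw [coeff_monomial, coeff_monomial]
          by_cases hi : i = a
          · have : j ≠ b := by
              rintro rfl; exact hne (by rw [hi])
            simp [this]
          · simp [hi]
        · intro h'; exact absurd (mem_antidiagonal.2 h) h'
      · refine (Finset.sum_eq_zero ?_).symm
        rintro ⟨a, b⟩ hab
        rw [mem_antidiagonal] at hab
        rw [coeff_monomial, coeff_monomial]
        by_cases hi : i = a
        · have : j ≠ b := by
            rintro rfl; exact h (by rw [hi]; exact hab)
          simp [this]
        · simp [hi]

/-- The two-sided ideal of skew polynomials without terms of degree less than five. -/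
def lowCoeffZero : TwoSidedIdeal (SkewPolynomial F) :=
  TwoSidedIdeal.mk' {p | ∀ n < 5, p.coeff n = 0} (fun _ _ => rfl)
    (fun {p q} hp hq n hn => by rw [coeff_add, hp n hn, hq n hn, add_zero])
    (fun {p} hp n hn => by rw [coeff_neg, hp n hn, neg_zero])
    (fun {p q} hq n hn => by
      rw [coeff_mul]
      refine Finset.sum_eq_zero fun ij h => ?_
      rw [hq _ (by have := mem_antidiagonal.1 h; omega), zero_pow (by positivity),
        mul_zero])
    (fun {p q} hp n hn => by
      rw [coeff_mul]
      refine Finset.sum_eq_zero fun ij h => ?_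
      rw [hp _ (by have := mem_antidiagonal.1 h; omega), zero_mul])

theorem mem_lowCoeffZero {p : SkewPolynomial F} : p ∈ lowCoeffZero ↔ ∀ n < 5, p.coeff n = 0 :=
  TwoSidedIdeal.mem_mk' _ _ _ _ _ _ _

/-- Every monomial of degree at least five is a left multiple of `X ^ 5`. This makes the first five
coefficients coordinates on `R`. -/
theorem idealX5_eq : idealX5 = lowCoeffZero := by
  refine le_antisymm (TwoSidedIdeal.span_le.2 ?_) fun p hp => ?_
  · rintro _ rfl
    rw [SetLike.mem_coe, mem_lowCoeffZero]
    intro n hn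
    rw [← monomial_one_right_eq_X_pow, coeff_monomial, if_neg (by omega)]
  · rw [mem_lowCoeffZero] at hp
    rw [← sum_monomial p, sum_def]
    refine sum_mem fun n hn => ?_
    have h5 : 5 ≤ n := by
      by_contra h
      exact (mem_support_iff.1 hn) (hp n (by omega))
    obtain ⟨k, rfl⟩ := Nat.exists_eq_add_of_le' h5
    rw [← monomial_mul_X_pow]
    exact TwoSidedIdeal.mul_mem_left _ _ _ (TwoSidedIdeal.subset_span rfl)

theorem mk_eq_mk_iff (p q : SkewPolynomial F) :
    idealX5.ringCon.mk' p = idealX5.ringCon.mk' q ↔ ∀ n < 5, p.coeff n = q.coeff n := by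
  change ((p : R) = (q : R)) ↔ _
  rw [RingCon.eq, TwoSidedIdeal.rel_iff, idealX5_eq, mem_lowCoeffZero]
  simp only [coeff_sub, sub_eq_zero]

/-- The coefficient of `x ^ n`. -/
def cf (n : ℕ) (r : R) : F := (Function.surjInv idealX5.ringCon.mk'_surjective r).coeff n

/-- `cf` reads the coefficient off a chosen lift; only below degree five is it independent of the
choice, whence the bound `n < 5` throughout. -/
theorem cf_mk {n : ℕ} (hn : n < 5) (p : SkewPolynomial F) :
    cf n (idealX5.ringCon.mk' p) = p.coeff n :=
  (mk_eq_mk_iff _ _).1 (Function.surjInv_eq idealX5.ringCon.mk'_surjective _) n hn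

theorem R_ext {r s : R} (h : ∀ n < 5, cf n r = cf n s) : r = s := by
  obtain ⟨p, rfl⟩ := idealX5.ringCon.mk'_surjective r
  obtain ⟨q, rfl⟩ := idealX5.ringCon.mk'_surjective s
  rw [mk_eq_mk_iff]
  intro n hn
  rw [← cf_mk hn, h n hn, cf_mk hn]

theorem cf_add {n : ℕ} (hn : n < 5) (r s : R) : cf n (r + s) = cf n r + cf n s := by
  obtain ⟨p, rfl⟩ := idealX5.ringCon.mk'_surjective r
  obtain ⟨q, rfl⟩ := idealX5.ringCon.mk'_surjective s
  rw [← map_add, cf_mk hn, cf_mk hn, cf_mk hn, coeff_add]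

theorem cf_sub {n : ℕ} (hn : n < 5) (r s : R) : cf n (r - s) = cf n r - cf n s := by
  obtain ⟨p, rfl⟩ := idealX5.ringCon.mk'_surjective r
  obtain ⟨q, rfl⟩ := idealX5.ringCon.mk'_surjective s
  rw [← map_sub, cf_mk hn, cf_mk hn, cf_mk hn, coeff_sub]

theorem cf_mul {n : ℕ} (hn : n < 5) (r s : R) :
    cf n (r * s) = ∑ ij ∈ antidiagonal n, cf ij.1 r * cf ij.2 s ^ 2 ^ ij.1 := by
  obtain ⟨p, rfl⟩ := idealX5.ringCon.mk'_surjective r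
  obtain ⟨q, rfl⟩ := idealX5.ringCon.mk'_surjective s
  rw [← map_mul, cf_mk hn, coeff_mul]
  refine Finset.sum_congr rfl fun ij h => ?_
  rw [cf_mk (by have := mem_antidiagonal.1 h; omega),
    cf_mk (by have := mem_antidiagonal.1 h; omega)]

theorem cf_one {n : ℕ} (hn : n < 5) : cf n 1 = if n = 0 then 1 else 0 := by
  rw [← map_one idealX5.ringCon.mk', cf_mk hn, coeff_one]
  simp only [eq_comm]

theorem cf_zero {n : ℕ} (hn : n < 5) : cf n 0 = 0 := by
  rw [← map_zero idealX5.ringCon.mk', cf_mk hn, coeff_zero]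

theorem cf_constR {n : ℕ} (hn : n < 5) (a : F) : cf n (constR a) = if n = 0 then a else 0 := by
  change cf n (idealX5.ringCon.mk' (C a)) = _
  rw [cf_mk hn, coeff_C]

theorem cf_galHom {n : ℕ} (hn : n < 5) (σ : Gal8) (r : R) : cf n (galHom σ r) = σ (cf n r) := by
  obtain ⟨p, rfl⟩ := idealX5.ringCon.mk'_surjective r
  rw [galHom_mk, cf_mk hn, cf_mk hn]
  induction p using SkewPolynomial.induction with
  | h0 => simp
  | ha i r p _ _ ih =>
    rw [map_add, coeff_add, coeff_add, map_add, ih, skewMap_monomial, coeff_monomial,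
      coeff_monomial]
    split_ifs <;> simp

/-- The element of `R` with given coefficients. -/
def elt (a₀ a₁ a₂ a₃ a₄ : F) : R :=
  idealX5.ringCon.mk' (monomial 0 a₀ + monomial 1 a₁ + monomial 2 a₂ + monomial 3 a₃ +
    monomial 4 a₄)

theorem cf_elt (a₀ a₁ a₂ a₃ a₄ : F) :
    cf 0 (elt a₀ a₁ a₂ a₃ a₄) = a₀ ∧ cf 1 (elt a₀ a₁ a₂ a₃ a₄) = a₁ ∧
    cf 2 (elt a₀ a₁ a₂ a₃ a₄) = a₂ ∧ cf 3 (elt a₀ a₁ a₂ a₃ a₄) = a₃ ∧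
    cf 4 (elt a₀ a₁ a₂ a₃ a₄) = a₄ := by
  refine ⟨?_, ?_, ?_, ?_, ?_⟩ <;>
  · rw [elt, cf_mk (by norm_num)]
    simp only [coeff_add, coeff_monomial]
    norm_num

/-- The constant coefficient as a ring homomorphism. -/
def cfZero : R →+* F where
  toFun := cf 0
  map_one' := by rw [cf_one (by norm_num), if_pos rfl]
  map_zero' := cf_zero (by norm_num)
  map_add' := cf_add (by norm_num)
  map_mul' r s := by rw [cf_mul (by norm_num)]; simp

theorem isNilpotent_of_cf_zero {r : R} (h : cf 0 r = 0) : IsNilpotent r := by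
  have key (k n : ℕ) (hn : n < 5) (hk : n < k) : cf n (r ^ k) = 0 := by
    induction k generalizing n with
    | zero => omega
    | succ k ih =>
      rw [pow_succ', cf_mul hn]
      refine Finset.sum_eq_zero fun ij hij => ?_
      rw [mem_antidiagonal] at hij
      by_cases h0 : ij.1 = 0
      · rw [h0, h, zero_mul]
      · rw [ih ij.2 (by omega) (by omega), zero_pow (by positivity), mul_zero]
  exact ⟨5, R_ext fun n hn => by rw [key 5 n hn hn, cf_zero hn]⟩

/-- The constant coefficient maps `R` onto a field, which has zero radical. Conversely, if `r` has
no constant term and lies outside a maximal left ideal `m`, then `1 = s + y r` with `s ∈ m`; but `y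
r` is nilpotent, so `s` is a unit. -/
theorem mem_jacobson_iff (r : R) : r ∈ Ring.jacobson R ↔ cf 0 r = 0 := by
  constructor
  · intro h
    have : RingHomSurjective cfZero := ⟨fun a => ⟨constR a, by
      change cf 0 _ = _; rw [cf_constR (by norm_num), if_pos rfl]⟩⟩
    have h1 : cfZero r ∈ Ring.jacobson F := Ring.le_comap_jacobson cfZero h
    rw [IsSemisimpleRing.jacobson_eq_bot] at h1
    exact h1
  · intro h
    change r ∈ Module.jacobson R R
    rw [Module.jacobson, Submodule.mem_sInf]
    intro m hm
    by_contra hr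
    have h1 : m ⊔ Submodule.span R {r} = ⊤ :=
      hm.2 _ (lt_of_le_of_ne le_sup_left fun h' => hr (by
        rw [h']; exact Submodule.mem_sup_right (Submodule.mem_span_singleton_self r)))
    obtain ⟨s, hs, t, ht, hst⟩ := Submodule.mem_sup.1 (h1 ▸ Submodule.mem_top : (1 : R) ∈ _)
    obtain ⟨y, rfl⟩ := Submodule.mem_span_singleton.1 ht
    have h2 : cf 0 (y • r) = 0 := by
      change cfZero (y * r) = 0
      rw [map_mul]; change _ * cf 0 r = 0; rw [h, mul_zero]
    have h3 : IsUnit s := by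
      rw [eq_sub_of_add_eq hst]
      exact (isNilpotent_of_cf_zero h2).isUnit_one_sub
    exact hm.1 (Ideal.eq_top_of_isUnit_mem m hs h3)

theorem mem_Q (u : Rˣ) : u ∈ Q ↔ cf 0 (u : R) = 1 := by
  change (u : R) - 1 ∈ Ring.jacobson R ↔ _
  rw [mem_jacobson_iff, cf_sub (by norm_num), cf_one (by norm_num), if_pos rfl, sub_eq_zero]

/-- The unit `1 + a x + b x² + c x³ + d x⁴`. -/
def qu (a b c d : F) : Rˣ :=
  (show IsUnit (elt 1 a b c d) by
    have h : IsNilpotent (elt 1 a b c d - 1) := isNilpotent_of_cf_zero (by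
      rw [cf_sub (by norm_num), cf_one (by norm_num), (cf_elt _ _ _ _ _).1]; simp)
    have := h.isUnit_one_add
    rwa [add_sub_cancel] at this).unit

variable (a b c d : F)

theorem qu_zero : cf 0 (qu a b c d : R) = 1 := (cf_elt _ _ _ _ _).1
theorem qu_mem : qu a b c d ∈ Q := (mem_Q _).2 (qu_zero a b c d)
@[simp] theorem qu_one : cf 1 (qu a b c d : R) = a := (cf_elt _ _ _ _ _).2.1
@[simp] theorem qu_two : cf 2 (qu a b c d : R) = b := (cf_elt _ _ _ _ _).2.2.1
@[simp] theorem qu_three : cf 3 (qu a b c d : R) = c := (cf_elt _ _ _ _ _).2.2.2.1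
@[simp] theorem qu_four : cf 4 (qu a b c d : R) = d := (cf_elt _ _ _ _ _).2.2.2.2

variable {a b c d}
variable {u v : Rˣ}

theorem Q_ext (hu : u ∈ Q) (hv : v ∈ Q) (h1 : cf 1 (u : R) = cf 1 (v : R))
    (h2 : cf 2 (u : R) = cf 2 (v : R)) (h3 : cf 3 (u : R) = cf 3 (v : R))
    (h4 : cf 4 (u : R) = cf 4 (v : R)) : u = v := by
  rw [mem_Q] at hu hv
  refine Units.ext (R_ext fun n hn => ?_)
  interval_cases n
  exacts [hu.trans hv.symm, h1, h2, h3, h4]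

theorem eq_qu (hu : u ∈ Q) : u = qu (cf 1 (u : R)) (cf 2 (u : R)) (cf 3 (u : R)) (cf 4 (u : R)) :=
  Q_ext hu (qu_mem _ _ _ _) (by simp) (by simp) (by simp) (by simp)

theorem cf_one_mul (hu : u ∈ Q) (hv : v ∈ Q) :
    cf 1 ((u * v : Rˣ) : R) = cf 1 (u : R) + cf 1 (v : R) := by
  rw [mem_Q] at hu hv
  rw [Units.val_mul, cf_mul (by norm_num)]
  simp [Finset.Nat.antidiagonal_succ, hu, hv, add_comm]

theorem cf_two_mul (hu : u ∈ Q) (hv : v ∈ Q) :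
    cf 2 ((u * v : Rˣ) : R) = cf 2 (u : R) + cf 2 (v : R) + cf 1 (u : R) * cf 1 (v : R) ^ 2 := by
  rw [mem_Q] at hu hv
  rw [Units.val_mul, cf_mul (by norm_num)]
  simp [Finset.Nat.antidiagonal_succ, hu, hv]
  ring

theorem cf_three_mul (hu : u ∈ Q) (hv : v ∈ Q) :
    cf 3 ((u * v : Rˣ) : R) = cf 3 (u : R) + cf 3 (v : R) + cf 1 (u : R) * cf 2 (v : R) ^ 2 +
      cf 2 (u : R) * cf 1 (v : R) ^ 4 := by
  rw [mem_Q] at hu hv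
  rw [Units.val_mul, cf_mul (by norm_num)]
  simp [Finset.Nat.antidiagonal_succ, hu, hv]
  ring

theorem pow_eight (a : F) : a ^ 8 = a := by
  have := Fintype.ofFinite F
  have h := FiniteField.pow_card a
  rwa [← Nat.card_eq_fintype_card, GaloisField.card 2 3 (by norm_num)] at h

/-- Moving a scalar past `x³` raises it to the eighth power, which is the identity; hence the last
term has no exponent. -/
theorem cf_four_mul (hu : u ∈ Q) (hv : v ∈ Q) :
    cf 4 ((u * v : Rˣ) : R) = cf 4 (u : R) + cf 4 (v : R) + cf 1 (u : R) * cf 3 (v : R) ^ 2 +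
      cf 2 (u : R) * cf 2 (v : R) ^ 4 + cf 3 (u : R) * cf 1 (v : R) := by
  rw [mem_Q] at hu hv
  rw [Units.val_mul, cf_mul (by norm_num)]
  simp [Finset.Nat.antidiagonal_succ, hu, hv, pow_eight]
  ring

theorem qu_mul_qu (a b c d a' b' c' d' : F) : qu a b c d * qu a' b' c' d' =
    qu (a + a') (b + b' + a * a' ^ 2) (c + c' + a * b' ^ 2 + b * a' ^ 4)
      (d + d' + a * c' ^ 2 + b * b' ^ 4 + c * a') := by
  have h := qu_mem a b c d
  have h' := qu_mem a' b' c' d'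
  refine Q_ext (mul_mem h h') (qu_mem _ _ _ _) ?_ ?_ ?_ ?_
  · rw [cf_one_mul h h']; simp
  · rw [cf_two_mul h h']; simp
  · rw [cf_three_mul h h']; simp
  · rw [cf_four_mul h h']; simp

theorem qu_inj {a b c d a' b' c' d' : F} :
    qu a b c d = qu a' b' c' d' ↔ a = a' ∧ b = b' ∧ c = c' ∧ d = d' := by
  refine ⟨fun h => ⟨?_, ?_, ?_, ?_⟩, by rintro ⟨rfl, rfl, rfl, rfl⟩; rfl⟩
  · simpa using congrArg (fun u : Rˣ => cf 1 (u : R)) h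
  · simpa using congrArg (fun u : Rˣ => cf 2 (u : R)) h
  · simpa using congrArg (fun u : Rˣ => cf 3 (u : R)) h
  · simpa using congrArg (fun u : Rˣ => cf 4 (u : R)) h

theorem qu_eq_one : qu 0 0 0 0 = 1 :=
  mul_eq_left.1 (by rw [qu_mul_qu]; simp : qu 0 0 0 0 * qu 0 0 0 0 = qu 0 0 0 0)

theorem cf_actCG {n : ℕ} (hn : n < 5) (h : CG) (u : Rˣ) :
    cf n (actCG h u : R) = h.left * h.right (cf n (u : R)) * ((h.left⁻¹ : Fˣ) : F) ^ 2 ^ n := by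
  have h1 : ((actCG h u : Rˣ) : R) =
      constR h.left * galHom h.right (u : R) * constR (h.left⁻¹ : Fˣ) := rfl
  have h2 (a : F) (r : R) : cf n (constR a * r) = a * cf n r := by
    rw [cf_mul hn, Finset.sum_eq_single (0, n)]
    · rw [cf_constR (by norm_num)]; simp
    · rintro ⟨i, j⟩ hij hne
      have := mem_antidiagonal.1 hij
      simp only at this
      rw [cf_constR (by simp; omega), if_neg, zero_mul]
      rintro rfl
      exact hne (by simpa using this)
    · intro h; exact absurd (by simp) h
  have h3 (a : F) (r : R) : cf n (r * constR a) = cf n r * a ^ 2 ^ n := by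
    rw [cf_mul hn, Finset.sum_eq_single (n, 0)]
    · rw [cf_constR (by norm_num)]; simp
    · rintro ⟨i, j⟩ hij hne
      have := mem_antidiagonal.1 hij
      simp only at this
      rw [cf_constR (by simp; omega), if_neg, zero_pow (by positivity), mul_zero]
      rintro rfl
      exact hne (by simpa using this)
    · intro h; exact absurd (by simp) h
  rw [h1, h3, h2, cf_galHom hn]

theorem actCG_qu (h : CG) (a b c d : F) : actCG h (qu a b c d) =
    qu (h.left ^ 6 * h.right a) (h.left ^ 4 * h.right b) (h.right c) (h.left ^ 6 * h.right d) := by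
  have h7 : (h.left : F) ^ 7 = 1 := by
    have := pow_eight (h.left : F)
    exact mul_left_cancel₀ h.left.ne_zero (by rw [← pow_succ', this, mul_one])
  have hi : ((h.left⁻¹ : Fˣ) : F) = h.left ^ 6 := by
    rw [Units.val_inv_eq_inv_val]
    exact inv_eq_of_mul_eq_one_right (by rw [← pow_succ', h7])
  have key (k m : ℕ) (e : F) (hk : k = 7 * m) : (h.left : F) ^ k * e = e := by
    rw [hk, pow_mul, h7, one_pow, one_mul]
  refine Q_ext ?_ (qu_mem _ _ _ _) ?_ ?_ ?_ ?_
  · rw [mem_Q, cf_actCG (by norm_num), qu_zero]; simp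
  all_goals rw [cf_actCG (by norm_num), hi]; simp only [qu_one, qu_two, qu_three, qu_four]
  -- With `t = h.left`, the scalars are `t ^ (1 + 6 * 2 ^ n)`, that is `t ^ 13`, `t ^ 25`, `t ^ 49`,
  -- `t ^ 97`. They are reduced modulo `t ^ 7 = 1`; the cofactors are geometric sums.
  · linear_combination (h.left ^ 6 * h.right a : F) * h7
  · linear_combination (h.left ^ 4 * h.right b : F) * (h.left ^ 14 + h.left ^ 7 + 1) * h7
  · linear_combination (h.right c : F) * (h.left ^ 42 + h.left ^ 35 + h.left ^ 28 + h.left ^ 21 +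
      h.left ^ 14 + h.left ^ 7 + 1) * h7
  · linear_combination (h.left ^ 6 * h.right d : F) * (h.left ^ 84 + h.left ^ 77 + h.left ^ 70 +
      h.left ^ 63 + h.left ^ 56 + h.left ^ 49 + h.left ^ 42 + h.left ^ 35 + h.left ^ 28 +
      h.left ^ 21 + h.left ^ 14 + h.left ^ 7 + 1) * h7

end RingCoordinates

/-! ### Arithmetic in the field with eight elements -/

section FieldArithmetic

theorem card_F : Nat.card F = 8 := by rw [GaloisField.card 2 3 (by norm_num)]; norm_num

theorem two_eq_zero : (2 : F) = 0 := CharP.cast_eq_zero F 2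

theorem add_self_eq_zero (a : F) : a + a = 0 := CharTwo.add_self_eq_zero a

theorem pow_seven {a : F} (ha : a ≠ 0) : a ^ 7 = 1 :=
  mul_left_cancel₀ ha (by rw [← pow_succ', pow_eight, mul_one])

theorem exists_ne_zero_ne (a : F) : ∃ b : F, b ≠ 0 ∧ b ≠ a := by
  classical
  have := Fintype.ofFinite F
  have h8 : Fintype.card F = 8 := by rw [← Nat.card_eq_fintype_card, card_F]
  by_contra! h
  have : (Finset.univ : Finset F) ⊆ {0, a} := fun b _ => by
    by_cases hb : b = 0
    · simp [hb]
    · simp [h b hb]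
  have h2 := Finset.card_le_card this
  rw [Finset.card_univ, h8] at h2
  have := h2.trans (Finset.card_le_two)
  omega

/-- The trace to the prime field, with values in `F`. -/
def tr (a : F) : F := a + a ^ 2 + a ^ 4

theorem tr_add (a b : F) : tr (a + b) = tr a + tr b := by
  have := two_eq_zero
  unfold tr; grind

theorem tr_zero : tr 0 = 0 := by simp [tr]

theorem tr_one : tr 1 = 1 := by
  have := two_eq_zero
  unfold tr; grind

theorem tr_sq (a : F) : tr (a ^ 2) = tr a := by
  have := pow_eight a
  unfold tr; grind

theorem tr_pow_four (a : F) : tr (a ^ 4) = tr a := by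
  rw [show a ^ 4 = (a ^ 2) ^ 2 by ring, tr_sq, tr_sq]

theorem tr_eq_zero_or_one (a : F) : tr a = 0 ∨ tr a = 1 := by
  have := pow_eight a
  have := two_eq_zero
  have h : tr a * (tr a - 1) = 0 := by unfold tr; grind
  exact (mul_eq_zero.1 h).imp id sub_eq_zero.1

theorem exists_sq_add_of_tr_eq_zero {a : F} (h : tr a = 0) : ∃ b, b ^ 2 + b = a := by
  -- As `a ^ 8 = a`, this gives `b ^ 2 + b = a ^ 2 + a ^ 4`, which is `a` when the trace vanishes.
  refine ⟨a + a ^ 4, ?_⟩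
  have := pow_eight a
  have := two_eq_zero
  unfold tr at h; grind

/-- The left side has trace `tr 1 = 1`, since `a ^ 2` and `a` have the same trace. -/
theorem sq_add_self_add_one_ne_zero (a : F) : a ^ 2 + a + 1 ≠ 0 := by
  intro h
  have h1 := congrArg tr h
  rw [tr_add, tr_add, tr_sq, add_self_eq_zero, tr_one, tr_zero, zero_add] at h1
  exact one_ne_zero h1

theorem exists_tr_eq_zero : ∃ a : F, a ≠ 0 ∧ tr a = 0 := by
  obtain ⟨b, hb0, hb1⟩ := exists_ne_zero_ne 1
  refine ⟨b ^ 2 + b, fun h => ?_, by rw [tr_add, tr_sq, add_self_eq_zero]⟩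
  have h2 : b * (b + 1) = 0 := by linear_combination h
  rcases mul_eq_zero.1 h2 with h | h
  · exact hb0 h
  · exact hb1 (by linear_combination h - two_eq_zero)

theorem sq_add_self_ne_zero {a : F} (h0 : a ≠ 0) (ha : tr a = 0) : a ^ 2 + a ≠ 0 := by
  intro h
  have h2 : a * (a + 1) = 0 := by linear_combination h
  rcases mul_eq_zero.1 h2 with h | h
  · exact h0 h
  · rw [show a = 1 by linear_combination h - two_eq_zero, tr_one] at ha
    exact one_ne_zero ha

/-- Elements of trace zero are the roots of `X (X ^ 3 + X + 1)`, so the nonzero ones are Galois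
conjugate. -/
theorem conjugate_of_tr_eq_zero {a b : F} (ha0 : a ≠ 0) (hb0 : b ≠ 0) (ha : tr a = 0)
    (hb : tr b = 0) : b = a ∨ b = a ^ 2 ∨ b = a ^ 4 := by
  have h2 := two_eq_zero
  have ha' : a ^ 3 + a + 1 = 0 := by
    refine (mul_eq_zero.1 (?_ : a * (a ^ 3 + a + 1) = 0)).resolve_left ha0
    unfold tr at ha; linear_combination ha
  have hb' : b ^ 3 + b + 1 = 0 := by
    refine (mul_eq_zero.1 (?_ : b * (b ^ 3 + b + 1) = 0)).resolve_left hb0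
    unfold tr at hb; linear_combination hb
  have h : (b - a) * ((b - a ^ 2) * (b - a ^ 4)) = 0 := by grind
  rcases mul_eq_zero.1 h with h | h
  · exact Or.inl (sub_eq_zero.1 h)
  · exact Or.inr ((mul_eq_zero.1 h).imp sub_eq_zero.1 sub_eq_zero.1)

theorem pow_four_surjective (a : F) : ∃ b : F, b ^ 4 = a :=
  ⟨a ^ 2, by rw [← pow_mul, pow_eight]⟩

/-- The Frobenius automorphism. -/
def frob : Gal8 := FiniteField.frobeniusAlgEquivOfAlgebraic (ZMod 2) F

theorem frob_apply (a : F) : frob a = a ^ 2 := by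
  rw [frob, FiniteField.coe_frobeniusAlgEquivOfAlgebraic]
  simp [ZMod.card]

theorem frob_frob_apply (a : F) : (frob * frob) a = a ^ 4 := by
  rw [AlgEquiv.mul_apply, frob_apply, frob_apply, ← pow_mul]

theorem card_Gal8 : Nat.card Gal8 = 3 := by
  rw [IsGalois.card_aut_eq_finrank, GaloisField.finrank 2 (by norm_num)]

theorem gal_cases (σ : Gal8) : σ = 1 ∨ (∀ a, σ a = a ^ 2) ∨ ∀ a, σ a = a ^ 4 := by
  obtain ⟨⟨n, hn⟩, rfl⟩ := (FiniteField.bijective_frobeniusAlgEquivOfAlgebraic_pow (ZMod 2) F).2 σ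
  rw [GaloisField.finrank 2 (by norm_num)] at hn
  change frob ^ n = 1 ∨ (∀ a, (frob ^ n) a = a ^ 2) ∨ ∀ a, (frob ^ n) a = a ^ 4
  interval_cases n
  · exact Or.inl (pow_zero _)
  · exact Or.inr (Or.inl fun a => by rw [pow_one, frob_apply])
  · exact Or.inr (Or.inr fun a => by rw [pow_two, frob_frob_apply])

theorem tr_gal (σ : Gal8) (a : F) : tr (σ a) = tr a := by
  rcases gal_cases σ with rfl | h | h
  · rfl
  · rw [h, tr_sq]
  · rw [h, tr_pow_four]

theorem gal_fixed {σ : Gal8} (hσ : σ ≠ 1) {a : F} (ha : a ≠ 0) (h : σ a = a) : a = 1 := by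
  have h8 := pow_eight a
  have h2 : a ^ 2 = a := by
    rcases gal_cases σ with h1 | h1 | h1
    · exact absurd h1 hσ
    · rw [← h1, h]
    · rw [h1] at h
      calc a ^ 2 = (a ^ 4) ^ 2 := by rw [h]
        _ = a := by rw [← pow_mul, h8]
  exact mul_left_cancel₀ ha (by rw [mul_one, ← pow_two, h2])

/-- A predicate on `F` which is a homomorphism to a group of order two and is invariant under
multiplication by nonzero elements is constant. -/
theorem forall_of_invariant {g : F → Prop} (hadd : ∀ a b, g (a + b) ↔ (g a ↔ g b))
    (hmul : ∀ t a, t ≠ 0 → (g (t * a) ↔ g a)) (a : F) : g a := by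
  have h1 (a : F) (ha : a ≠ 0) : g a ↔ g 1 := by
    rw [← hmul a 1 ha, mul_one]
  -- `b`, `1` and `b + 1` are all nonzero, so additivity becomes `g 1 ↔ (g 1 ↔ g 1)`, which forces
  -- `g 1`.
  obtain ⟨b, hb0, hb⟩ := exists_ne_zero_ne 1
  have hb1 : b + 1 ≠ 0 := fun h => hb (by linear_combination h - two_eq_zero)
  have h2 := hadd b 1
  rw [h1 _ hb1, h1 _ hb0] at h2
  by_cases ha : a = 0
  · have := hadd 0 0
    rw [add_zero] at this
    rw [ha]; tauto
  · rw [h1 a ha]; tauto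

end FieldArithmetic

/-! ### The invariant subgroup of index two -/

section InvariantSubgroup

/-- The function whose trace is a homomorphism on `Q`. -/
def lam (u : Rˣ) : F := cf 3 (u : R) + cf 1 (u : R) ^ 4 * cf 2 (u : R) + cf 1 (u : R) ^ 7

theorem lam_qu (a b c d : F) : lam (qu a b c d) = c + a ^ 4 * b + a ^ 7 := by simp [lam]

/-- The defect `a b'² + b a'⁴` of `c` is cancelled under the trace by that of `a⁴ b`, since `tr (a
b'²) = tr (a⁴ b')`. This leaves `a⁵ a'² + a a'⁶`. The mixed terms of `(a + a')⁷` form two Frobenius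
orbits of three monomials, those of `a⁵ a'²` and `a a'⁶`, so their trace cancels the rest. -/
theorem tr_lam_mul {u v : Rˣ} (hu : u ∈ Q) (hv : v ∈ Q) :
    tr (lam (u * v)) = tr (lam u) + tr (lam v) := by
  rw [eq_qu hu, eq_qu hv, qu_mul_qu, lam_qu, lam_qu, lam_qu]
  generalize cf 1 (u : R) = a
  generalize cf 2 (u : R) = b
  generalize cf 3 (u : R) = c
  generalize cf 1 (v : R) = a'
  generalize cf 2 (v : R) = b'
  generalize cf 3 (v : R) = c'
  have := pow_eight a
  have := pow_eight b
  have := pow_eight a'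
  have := pow_eight b'
  have := two_eq_zero
  unfold tr
  grind

theorem actCG_mem_Q (h : CG) {u : Rˣ} (hu : u ∈ Q) : actCG h u ∈ Q := by
  rw [eq_qu hu, actCG_qu]; exact qu_mem _ _ _ _

/-- Each of `c`, `a⁴ b` and `a⁷` is scaled by a power of `t ^ 7 = 1`, and the trace is Galois
invariant. -/
theorem tr_lam_actCG (h : CG) {u : Rˣ} (hu : u ∈ Q) : tr (lam (actCG h u)) = tr (lam u) := by
  rw [eq_qu hu, actCG_qu, lam_qu, lam_qu]
  have h7 : (h.left : F) ^ 7 = 1 := pow_seven h.left.ne_zero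
  refine (congrArg tr ?_).trans (tr_gal h.right _)
  simp only [map_add, map_mul, map_pow]
  linear_combination
    (h.right (cf 1 (u : R)) ^ 4 * h.right (cf 2 (u : R)) * ((h.left : F) ^ 21 + h.left ^ 14 +
      h.left ^ 7 + 1) + h.right (cf 1 (u : R)) ^ 7 * ((h.left : F) ^ 35 + h.left ^ 28 +
      h.left ^ 21 + h.left ^ 14 + h.left ^ 7 + 1)) * h7

/-- The invariant subgroup of index two of `Q`. -/
def traceSubgroup : Subgroup Rˣ where
  carrier := {u | u ∈ Q ∧ tr (lam u) = 0}
  one_mem' := ⟨one_mem Q, by rw [← qu_eq_one, lam_qu]; simp [tr]⟩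
  mul_mem' := fun {u v} hu hv =>
    ⟨mul_mem hu.1 hv.1, by rw [tr_lam_mul hu.1 hv.1, hu.2, hv.2, add_zero]⟩
  inv_mem' := fun {u} hu => ⟨inv_mem hu.1, by
    have h := tr_lam_mul hu.1 (inv_mem hu.1)
    rw [mul_inv_cancel, hu.2, zero_add, ← qu_eq_one, lam_qu] at h
    rw [← h]; simp [tr]⟩

theorem mem_traceSubgroup {u : Rˣ} : u ∈ traceSubgroup ↔ u ∈ Q ∧ tr (lam u) = 0 := Iff.rfl

theorem qu_mem_traceSubgroup {a b c d : F} :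
    qu a b c d ∈ traceSubgroup ↔ tr (c + a ^ 4 * b + a ^ 7) = 0 := by
  rw [mem_traceSubgroup, lam_qu, and_iff_right (qu_mem a b c d)]

theorem isInvariantIndexTwo_traceSubgroup : IsInvariantIndexTwo traceSubgroup where
  le _ h := h.1
  invariant h u hu := ⟨actCG_mem_Q h hu.1, by rw [tr_lam_actCG h hu.1, hu.2]⟩
  index := by
    rw [Subgroup.relIndex_eq_two_iff]
    refine ⟨qu 0 0 1 0, qu_mem _ _ _ _, fun u hu => ?_⟩
    rw [mem_traceSubgroup, mem_traceSubgroup, tr_lam_mul hu (qu_mem _ _ _ _), lam_qu,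
      and_iff_right hu, and_iff_right (mul_mem hu (qu_mem _ _ _ _))]
    simp only [ne_eq, OfNat.ofNat_ne_zero, not_false_eq_true, zero_pow, zero_mul, add_zero, tr_one]
    rcases tr_eq_zero_or_one (lam u) with h | h <;> rw [h]
    · right; simp
    · left; simp [add_self_eq_zero]

/-- A predicate which is a homomorphism from `Q` to a group of order two, is invariant under
conjugation by constants, and is trivial on the elements `1 + c x ^ 3`, is trivial. -/
theorem forall_mem_Q_of_invariant {k : Rˣ → Prop}
    (hmul : ∀ u ∈ Q, ∀ v ∈ Q, (k (u * v) ↔ (k u ↔ k v)))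
    (hact : ∀ t : Fˣ, ∀ u ∈ Q, (k (actCG (SemidirectProduct.inl t) u) ↔ k u))
    (h3 : ∀ c, k (qu 0 0 c 0)) {u : Rˣ} (hu : u ∈ Q) : k u := by
  have hq (a b c d a' b' c' d' : F) := hmul _ (qu_mem a b c d) _ (qu_mem a' b' c' d')
  simp only [qu_mul_qu] at hq
  have ht (t : F) (ht0 : t ≠ 0) (a b c d : F) :
      k (qu (t ^ 6 * a) (t ^ 4 * b) c (t ^ 6 * d)) ↔ k (qu a b c d) := by
    rw [← hact (Units.mk0 t ht0) _ (qu_mem a b c d), actCG_qu]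
    simp
  -- `6 * 6` and `2 * 4` are `1` modulo `7`: acting by `t ^ 6`, respectively `t ^ 2`, scales the
  -- layer in question by `t` itself.
  have h36 (t : F) : (t ^ 6) ^ 6 = t := by
    rw [← pow_mul, show 6 * 6 = 8 * 4 + 4 by norm_num, pow_add, pow_mul, pow_eight,
      ← pow_add, pow_eight]
  have h8 (t : F) : (t ^ 2) ^ 4 = t := by rw [← pow_mul, pow_eight]
  have h4 (d : F) : k (qu 0 0 0 d) := by
    refine forall_of_invariant (g := fun d => k (qu 0 0 0 d)) (fun a b => ?_) (fun t a ht0 => ?_) d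
    · simpa using hq 0 0 0 a 0 0 0 b
    · simpa [h36] using ht (t ^ 6) (pow_ne_zero _ ht0) 0 0 0 a
  have h2 (b : F) : k (qu 0 b 0 0) := by
    refine forall_of_invariant (g := fun b => k (qu 0 b 0 0)) (fun a b => ?_) (fun t a ht0 => ?_) b
    · have h1 := hq 0 a 0 0 0 b 0 0
      have h2 := hq 0 (a + b) 0 0 0 0 0 (a * b ^ 4)
      simp at h1 h2
      have := h4 (a * b ^ 4)
      tauto
    · simpa [h8] using ht (t ^ 2) (pow_ne_zero _ ht0) 0 a 0 0
  have h234 (b c d : F) : k (qu 0 b c d) := by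
    have h1 := hq 0 b 0 0 0 0 c 0
    have h2' := hq 0 b c 0 0 0 0 d
    simp at h1 h2'
    have := h2 b
    have := h3 c
    have := h4 d
    tauto
  have hred (a b c d : F) : k (qu a b c d) ↔ k (qu a 0 0 0) := by
    -- Splits off the right factor `1 + a x`; the coefficients are those of the left factor, which
    -- has no linear term.
    have := hq 0 b (c + b * a ^ 4) (d + (c + b * a ^ 4) * a) a 0 0 0
    have h1 := h234 b (c + b * a ^ 4) (d + (c + b * a ^ 4) * a)
    simp [add_assoc, add_self_eq_zero] at this
    tauto
  have h1 (a : F) : k (qu a 0 0 0) := by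
    refine forall_of_invariant (g := fun a => k (qu a 0 0 0)) (fun a b => ?_) (fun t a ht0 => ?_) a
    · have h1 := hq a 0 0 0 b 0 0 0
      rwa [hred] at h1
    · simpa [h36] using ht (t ^ 6) (pow_ne_zero _ ht0) a 0 0 0
  rw [eq_qu hu, hred]
  exact h1 _

theorem IsInvariantIndexTwo.eq_traceSubgroup {P : Subgroup Rˣ} (hP : IsInvariantIndexTwo P) :
    P = traceSubgroup := by
  have hmul (u : Rˣ) (hu : u ∈ Q) (v : Rˣ) (hv : v ∈ Q) : u * v ∈ P ↔ (u ∈ P ↔ v ∈ P) :=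
    Subgroup.mul_mem_iff_of_index_two (H := P.subgroupOf Q) hP.index (a := ⟨u, hu⟩) (b := ⟨v, hv⟩)
  have hact (h : CG) (u : Rˣ) : actCG h u ∈ P ↔ u ∈ P := by
    refine ⟨fun hu => ?_, hP.invariant h u⟩
    have := hP.invariant h⁻¹ _ hu
    rw [map_inv] at this
    exact ((actCG h).symm_apply_apply u) ▸ this
  have h3add (c c' : F) : qu 0 0 (c + c') 0 ∈ P ↔ (qu 0 0 c 0 ∈ P ↔ qu 0 0 c' 0 ∈ P) := by
    rw [← hmul _ (qu_mem _ _ _ _) _ (qu_mem _ _ _ _), qu_mul_qu]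
    simp
  have h3gal (c : F) : qu 0 0 (c ^ 2) 0 ∈ P ↔ qu 0 0 c 0 ∈ P := by
    rw [← hact (SemidirectProduct.inr frob) (qu 0 0 c 0), actCG_qu]
    simp [frob_apply]
  have h3zero {c : F} (hc : tr c = 0) : qu 0 0 c 0 ∈ P := by
    obtain ⟨b, rfl⟩ := exists_sq_add_of_tr_eq_zero hc
    rw [h3add, h3gal]
  have h3one {c : F} (hc : tr c = 1) : qu 0 0 c 0 ∈ P ↔ qu 0 0 1 0 ∈ P := by
    have := h3zero (c := c + 1) (by rw [tr_add, hc, tr_one, add_self_eq_zero])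
    rwa [h3add] at this
  have h1 : qu 0 0 1 0 ∉ P := by
    intro h1
    obtain ⟨a, haQ, ha⟩ := Subgroup.relIndex_eq_two_iff.1 hP.index
    have key : ∀ u ∈ Q, u ∈ P := fun u hu =>
      forall_mem_Q_of_invariant (k := (· ∈ P)) hmul (fun t u _ => hact _ u) (fun c => by
        rcases tr_eq_zero_or_one c with h | h
        · exact h3zero h
        · exact (h3one h).2 h1) hu
    rcases ha 1 (one_mem Q) with h | h
    · exact h.2 (one_mem P)
    · exact h.2 (key _ (mul_mem (one_mem Q) haQ))
  ext u
  by_cases hu : u ∈ Q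
  · rw [mem_traceSubgroup, and_iff_right hu]
    -- Agreement of two homomorphisms to a group of order two is again such a homomorphism, so it
    -- need only be checked on the cubic layer.
    refine forall_mem_Q_of_invariant (k := fun u => u ∈ P ↔ tr (lam u) = 0) (fun u hu v hv => ?_)
      (fun t u hu => ?_) (fun c => ?_) hu
    · rw [hmul u hu v hv, tr_lam_mul hu hv]
      rcases tr_eq_zero_or_one (lam u) with h | h <;> rcases tr_eq_zero_or_one (lam v) with h' | h' <;>
        simp [h, h', add_self_eq_zero] <;> tauto
    · rw [hact, tr_lam_actCG _ hu]
    · rw [lam_qu]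
      rcases tr_eq_zero_or_one c with h | h
      · simp [h, h3zero h]
      · simp [h, h3one h, h1]
  · exact ⟨fun h => absurd (hP.le h) hu, fun h => absurd h.1 hu⟩

end InvariantSubgroup

/-! ### The structure of the subgroup of index two -/

section Structure

theorem card_Q : Nat.card Q = 2 ^ 12 := by
  let e : F × F × F × F ≃ Q :=
    { toFun := fun p => ⟨qu p.1 p.2.1 p.2.2.1 p.2.2.2, qu_mem _ _ _ _⟩
      invFun := fun u => (cf 1 (u.1 : R), cf 2 (u.1 : R), cf 3 (u.1 : R), cf 4 (u.1 : R))
      left_inv := fun p => by simp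
      right_inv := fun u => Subtype.ext (eq_qu u.2).symm }
  rw [← Nat.card_congr e]
  simp only [Nat.card_prod, card_F]
  norm_num

theorem card_traceSubgroup : Nat.card traceSubgroup = 2 ^ 11 := by
  have h := (traceSubgroup.subgroupOf Q).card_mul_index
  rw [card_Q, show (traceSubgroup.subgroupOf Q).index = 2 from
    isInvariantIndexTwo_traceSubgroup.index,
    Nat.card_congr (Subgroup.subgroupOfEquivOfLe isInvariantIndexTwo_traceSubgroup.le).toEquiv] at h
  omega

instance : Finite traceSubgroup :=
  Nat.finite_of_card_ne_zero (by rw [card_traceSubgroup]; norm_num)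

/-- The element `1 + a x + b x² + c x³ + d x⁴` of the subgroup of index two. -/
def tq (a b c d : F) (h : tr (c + a ^ 4 * b + a ^ 7) = 0) : traceSubgroup :=
  ⟨qu a b c d, qu_mem_traceSubgroup.2 h⟩

theorem exists_eq_tq (p : traceSubgroup) : ∃ a b c d h, p = tq a b c d h := by
  obtain ⟨u, hu⟩ := p
  have h := eq_qu hu.1
  exact ⟨_, _, _, _, hu.2, Subtype.ext h⟩

theorem tq_inj {a b c d a' b' c' d' : F} {h h'} :
    tq a b c d h = tq a' b' c' d' h' ↔ a = a' ∧ b = b' ∧ c = c' ∧ d = d' := by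
  rw [Subtype.ext_iff]; exact qu_inj

theorem tq_mul_tq {a b c d a' b' c' d' : F} {h h'} : ∃ h'', tq a b c d h * tq a' b' c' d' h' =
    tq (a + a') (b + b' + a * a' ^ 2) (c + c' + a * b' ^ 2 + b * a' ^ 4)
      (d + d' + a * c' ^ 2 + b * b' ^ 4 + c * a') h'' := by
  have := (tq a b c d h * tq a' b' c' d' h').2
  rw [Subgroup.coe_mul] at this
  simp only [tq, qu_mul_qu] at this
  exact ⟨qu_mem_traceSubgroup.1 this, Subtype.ext (qu_mul_qu _ _ _ _ _ _ _ _)⟩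

theorem tq_one {h} : tq 0 0 0 0 h = 1 := Subtype.ext qu_eq_one

theorem tq_mul_eq_iff {a b c d a' b' c' d' e f g k : F} {h h' h''} :
    tq a b c d h * tq a' b' c' d' h' = tq e f g k h'' ↔ a + a' = e ∧ b + b' + a * a' ^ 2 = f ∧
      c + c' + a * b' ^ 2 + b * a' ^ 4 = g ∧ d + d' + a * c' ^ 2 + b * b' ^ 4 + c * a' = k := by
  obtain ⟨_, h1⟩ := tq_mul_tq (h := h) (h' := h')
  rw [h1, tq_inj]

/-- With the cubic coefficient `a ^ 4 * b + a ^ 7`, any prescribed `a` and `b` are realised in the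
subgroup of index two. -/
theorem tr_section (a b : F) : tr (a ^ 4 * b + a ^ 7 + a ^ 4 * b + a ^ 7) = 0 := by
  rw [show a ^ 4 * b + a ^ 7 + a ^ 4 * b + a ^ 7 = (a ^ 4 * b + a ^ 7) + (a ^ 4 * b + a ^ 7) by ring,
    add_self_eq_zero, tr_zero]

theorem commute_tq_iff {a b c d a' b' c' d' : F} {h h'} :
    tq a b c d h * tq a' b' c' d' h' = tq a' b' c' d' h' * tq a b c d h ↔
      a * a' ^ 2 = a' * a ^ 2 ∧ a * b' ^ 2 + b * a' ^ 4 = a' * b ^ 2 + b' * a ^ 4 ∧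
      a * c' ^ 2 + b * b' ^ 4 + c * a' = a' * c ^ 2 + b' * b ^ 4 + c' * a := by
  obtain ⟨_, h1⟩ := tq_mul_tq (h := h') (h' := h)
  rw [h1, tq_mul_eq_iff]
  constructor
  · rintro ⟨_, h2, h3, h4⟩
    refine ⟨?_, ?_, ?_⟩
    · linear_combination h2
    · linear_combination h3
    · linear_combination h4
  · rintro ⟨h2, h3, h4⟩
    refine ⟨add_comm _ _, ?_, ?_, ?_⟩
    · linear_combination h2
    · linear_combination h3
    · linear_combination h4

theorem eq_of_pow_three_eq {a b : F} (h : a ^ 3 = b ^ 3) : a = b := by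
  have key (c : F) : (c ^ 3) ^ 5 = c := by
    rw [← pow_mul, show 3 * 5 = 8 + 7 by norm_num, pow_add, pow_eight, ← pow_succ', pow_eight]
  rw [← key a, h, key b]

theorem eq_zero_of_forall_mul_sq {a : F} (h : ∀ b : F, a * b ^ 2 = b * a ^ 2) : a = 0 := by
  by_contra ha
  obtain ⟨b, hb0, hb⟩ := exists_ne_zero_ne a
  have h1 : a * (b * (b - a)) = 0 := by linear_combination h b
  simp [ha, hb0, sub_eq_zero, hb] at h1

theorem eq_zero_of_forall_mul_pow_four {b : F} (h : ∀ a : F, b * a ^ 4 = a * b ^ 2) : b = 0 := by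
  by_contra hb
  obtain ⟨a, ha0, ha⟩ : ∃ a : F, a ≠ 0 ∧ a ^ 3 ≠ b := by
    by_cases hb1 : b = 1
    · obtain ⟨a, ha0, ha⟩ := exists_ne_zero_ne 1
      exact ⟨a, ha0, fun h => ha (eq_of_pow_three_eq (by rw [h, hb1, one_pow]))⟩
    · exact ⟨1, one_ne_zero, by rw [one_pow]; exact Ne.symm hb1⟩
  have h1 : b * (a * (a ^ 3 - b)) = 0 := by linear_combination h a
  simp [ha0, hb, sub_eq_zero, ha] at h1

theorem tq_mem_center {a b c d : F} {h} :
    tq a b c d h ∈ Subgroup.center traceSubgroup ↔ a = 0 ∧ b = 0 ∧ c = 0 := by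
  rw [Subgroup.mem_center_iff]
  constructor
  · intro hc
    have key (a' : F) := commute_tq_iff.1 (hc (tq a' 0 (a' ^ 4 * 0 + a' ^ 7) 0 (tr_section a' 0)))
    have ha : a = 0 := eq_zero_of_forall_mul_sq fun a' => (key a').1.symm
    subst ha
    have hb : b = 0 := eq_zero_of_forall_mul_pow_four fun a' => by
      linear_combination -(key a').2.1
    subst hb
    refine ⟨rfl, rfl, ?_⟩
    by_contra hc0
    -- Commuting with an element of linear coefficient `1` forces `c ^ 2 = c`; the value `c = 1` is
    -- excluded by its trace.
    have h1 := (key 1).2.2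
    have h2 : tr c = 0 := by simpa using h
    exact sq_add_self_ne_zero hc0 h2 (by linear_combination h1 + c * two_eq_zero)
  · rintro ⟨rfl, rfl, rfl⟩ p
    obtain ⟨a', b', c', d', h', rfl⟩ := exists_eq_tq p
    rw [commute_tq_iff]
    simp

theorem tq_mem_upperCentralSeries_two {a b c d : F} {h} :
    tq a b c d h ∈ Subgroup.upperCentralSeries traceSubgroup 2 ↔ a = 0 ∧ b = 0 := by
  rw [Subgroup.mem_upperCentralSeries_succ_iff]
  simp only [Subgroup.upperCentralSeries_one, commutatorElement_def]
  constructor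
  · intro hc
    have key (a' : F) : a * a' ^ 2 = a' * a ^ 2 ∧
        a * 0 ^ 2 + b * a' ^ 4 = a' * b ^ 2 + 0 * a ^ 4 := by
      let q := tq a' 0 (a' ^ 4 * 0 + a' ^ 7) 0 (tr_section a' 0)
      have h1 := hc q
      obtain ⟨a₁, b₁, c₁, d₁, h', hz⟩ := exists_eq_tq (tq a b c d h * q * (tq a b c d h)⁻¹ * q⁻¹)
      rw [hz, tq_mem_center] at h1
      obtain ⟨rfl, rfl, rfl⟩ := h1
      -- The commutator is central, hence purely of degree four, so the coefficients of `x²` and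
      -- `x³` must agree as for commuting elements.
      have h2 : tq a b c d h * q = tq 0 0 0 d₁ h' * (q * tq a b c d h) := by
        rw [← hz]; group
      obtain ⟨_, h3⟩ := tq_mul_tq (h := tr_section a' 0) (h' := h)
      obtain ⟨_, h4⟩ := tq_mul_tq (h := h) (h' := tr_section a' 0)
      rw [h3, h4, eq_comm, tq_mul_eq_iff] at h2
      exact ⟨by linear_combination -h2.2.1, by linear_combination -h2.2.2.1⟩
    have ha : a = 0 := eq_zero_of_forall_mul_sq fun a' => (key a').1
    subst ha
    have hb : b = 0 := eq_zero_of_forall_mul_pow_four fun a' => by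
      linear_combination (key a').2
    exact ⟨rfl, hb⟩
  · rintro ⟨rfl, rfl⟩ p
    obtain ⟨a', b', c', d', h', rfl⟩ := exists_eq_tq p
    have h1 : tq 0 0 c d h * tq a' b' c' d' h' =
        tq 0 0 0 (c * a' + a' * c ^ 2) (by simp [tr_zero]) * (tq a' b' c' d' h' * tq 0 0 c d h) := by
      obtain ⟨_, h2⟩ := tq_mul_tq (h := h') (h' := h)
      obtain ⟨_, h3⟩ := tq_mul_tq (h := h) (h' := h')
      rw [h2, h3, eq_comm, tq_mul_eq_iff]
      refine ⟨by ring, by ring, by ring, ?_⟩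
      linear_combination a' * c ^ 2 * two_eq_zero
    rw [h1, show ∀ x y z : traceSubgroup, z * (y * x) * x⁻¹ * y⁻¹ = z from fun x y z => by group,
      tq_mem_center]
    exact ⟨rfl, rfl, rfl⟩

end Structure

/-! ### Suzuki groups of type A -/

section SuzukiTypeA

variable {K : Type*} [Field K] (θ : K ≃+* K)

/-- The element of `A(K, θ)` with given parameters. -/
def smk (a b : K) : suzukiTypeA θ :=
  ⟨⟨!![1, 0, 0; a, 1, 0; b, θ a, 1], !![1, 0, 0; -a, 1, 0; θ a * a - b, -θ a, 1], by
      ext i j; fin_cases i <;> fin_cases j <;> simp [Matrix.mul_apply, Fin.sum_univ_three]; ring, by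
      ext i j; fin_cases i <;> fin_cases j <;> simp [Matrix.mul_apply, Fin.sum_univ_three]; ring⟩,
    a, b, rfl⟩

variable {θ}

theorem exists_eq_smk (M : suzukiTypeA θ) : ∃ a b, M = smk θ a b := by
  obtain ⟨a, b, h⟩ := M.2
  exact ⟨a, b, Subtype.ext (Units.ext h)⟩

theorem smk_inj {a b c d : K} : smk θ a b = smk θ c d ↔ a = c ∧ b = d := by
  refine ⟨fun h => ?_, by rintro ⟨rfl, rfl⟩; rfl⟩
  have h1 : !![1, 0, 0; a, 1, 0; b, θ a, 1] = !![1, 0, 0; c, 1, 0; d, θ c, 1] :=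
    congrArg (fun M : suzukiTypeA θ => (M.1 : Matrix (Fin 3) (Fin 3) K)) h
  exact ⟨by simpa using congrFun (congrFun h1 1) 0, by simpa using congrFun (congrFun h1 2) 0⟩

theorem smk_mul_smk (a b c d : K) :
    smk θ a b * smk θ c d = smk θ (a + c) (b + θ a * c + d) := by
  refine Subtype.ext (Units.ext ?_)
  change !![1, 0, 0; a, 1, 0; b, θ a, 1] * !![1, 0, 0; c, 1, 0; d, θ c, 1] =
    !![1, 0, 0; a + c, 1, 0; b + θ a * c + d, θ (a + c), 1]
  ext i j; fin_cases i <;> fin_cases j <;> simp [Matrix.mul_apply, Fin.sum_univ_three]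

theorem smk_zero : smk θ 0 0 = 1 := by
  refine mul_eq_left.1 (?_ : smk θ 0 0 * smk θ 0 0 = smk θ 0 0)
  rw [smk_mul_smk]; simp

variable (θ) in
/-- The parameters of the elements of `A(K, θ)`. -/
def smkEquiv : K × K ≃ suzukiTypeA θ :=
  Equiv.ofBijective (fun p => smk θ p.1 p.2)
    ⟨fun p q h => Prod.ext (smk_inj.1 h).1 (smk_inj.1 h).2, fun M => by
      obtain ⟨a, b, rfl⟩ := exists_eq_smk M
      exact ⟨(a, b), rfl⟩⟩

variable (θ) in
/-- The automorphism of `A(K, θ)` given by a nonzero scalar. -/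
def smkScale : Kˣ →* MulAut (suzukiTypeA θ) where
  toFun t :=
    { (smkEquiv θ).symm.trans
        ((Equiv.prodCongr (Units.mulLeft t) (Units.mulLeft (t * Units.map θ t))).trans
          (smkEquiv θ)) with
      map_mul' := fun M N => by
        obtain ⟨p, rfl⟩ := (smkEquiv θ).surjective M
        obtain ⟨q, rfl⟩ := (smkEquiv θ).surjective N
        have h : smkEquiv θ p * smkEquiv θ q =
          smkEquiv θ (p.1 + q.1, p.2 + θ p.1 * q.1 + q.2) := smk_mul_smk _ _ _ _
        simp only [Equiv.toFun_as_coe, h, Equiv.trans_apply, Equiv.symm_apply_apply]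
        refine Eq.trans ?_ (smk_mul_smk _ _ _ _).symm
        refine smk_inj.2 ⟨mul_add _ _ _, ?_⟩
        simp
        ring }
  map_one' := by
    ext1 M
    obtain ⟨p, rfl⟩ := (smkEquiv θ).surjective M
    change smkEquiv θ _ = _
    simp
  map_mul' s t := by
    ext1 M
    obtain ⟨⟨a, b⟩, rfl⟩ := (smkEquiv θ).surjective M
    change _ = smkEquiv θ ((Equiv.prodCongr _ _) ((smkEquiv θ).symm (smkEquiv θ _)))
    rw [Equiv.symm_apply_apply, Equiv.symm_apply_apply]
    simp [mul_assoc, mul_left_comm]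

theorem smkScale_smk (t : Kˣ) (a b : K) :
    smkScale θ t (smk θ a b) = smk θ (t * a) (t * θ t * b) := by
  change smkEquiv θ _ = _
  rw [show smk θ a b = smkEquiv θ (a, b) from rfl, Equiv.symm_apply_apply]
  rfl

theorem card_suzukiTypeA (θ : F ≃+* F) : Nat.card (suzukiTypeA θ) = 64 := by
  rw [← Nat.card_congr (smkEquiv θ), Nat.card_prod, card_F]

theorem orderOf_smk_eq_two {θ : F ≃+* F} {a b : F} :
    orderOf (smk θ a b) = 2 ↔ a = 0 ∧ b ≠ 0 := by
  have : Fact (Nat.Prime 2) := ⟨Nat.prime_two⟩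
  rw [orderOf_eq_prime_iff, pow_two, smk_mul_smk, ← smk_zero, smk_inj, ne_eq, smk_inj]
  constructor
  · rintro ⟨⟨_, h⟩, h'⟩
    have h1 : θ a * a = 0 := by linear_combination h - b * two_eq_zero
    have ha : a = 0 := by simpa using h1
    exact ⟨ha, fun hb => h' ⟨ha, hb⟩⟩
  · rintro ⟨rfl, hb⟩
    exact ⟨⟨by simp, by simp [add_self_eq_zero]⟩, fun h => hb h.2⟩

theorem isSuzukiTwoGroup_suzukiTypeA {θ : F ≃+* F} (hθ : ∀ a, θ a = a ^ 2) :
    IsSuzukiTwoGroup (suzukiTypeA θ) where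
  finite := Nat.finite_of_card_ne_zero (by rw [card_suzukiTypeA]; norm_num)
  isPGroup := IsPGroup.of_card (n := 6) (by rw [card_suzukiTypeA]; norm_num)
  nonabelian := by
    obtain ⟨t, ht0, ht1⟩ := exists_ne_zero_ne 1
    refine ⟨smk θ 1 0, smk θ t 0, fun h => ht1 ?_⟩
    rw [smk_mul_smk, smk_mul_smk, smk_inj, hθ, hθ] at h
    exact mul_left_cancel₀ ht0 (by linear_combination -h.2)
  two_involutions := by
    obtain ⟨t, ht0, ht1⟩ := exists_ne_zero_ne 1
    exact ⟨smk θ 0 1, smk θ 0 t, orderOf_smk_eq_two.2 ⟨rfl, one_ne_zero⟩,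
      orderOf_smk_eq_two.2 ⟨rfl, ht0⟩, fun h => ht1 (smk_inj.1 h).2.symm⟩
  transitive := by
    refine ⟨(smkScale θ).range, Group.isSolvable_of_surjective (smkScale θ).rangeRestrict_surjective,
      fun M N hM hN => ?_⟩
    obtain ⟨a, b, rfl⟩ := exists_eq_smk M
    obtain ⟨c, d, rfl⟩ := exists_eq_smk N
    obtain ⟨rfl, hb⟩ := orderOf_smk_eq_two.1 hM
    obtain ⟨rfl, hd⟩ := orderOf_smk_eq_two.1 hN
    -- The scalar `t` acts on involutions by `t * t ^ 2 = t ^ 3`, and the fifth power is the inverse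
    -- of cubing since `s ^ 15 = s`.
    refine ⟨_, ⟨Units.mk0 ((d / b) ^ 5) (pow_ne_zero _ (div_ne_zero hd hb)), rfl⟩, ?_⟩
    rw [smkScale_smk, smk_inj, hθ, Units.val_mk0]
    refine ⟨mul_zero _, ?_⟩
    have h1 : (d / b) ^ 5 * ((d / b) ^ 5) ^ 2 = d / b := by
      linear_combination ((d / b) ^ 7 + 1) * pow_eight (d / b)
    rw [h1, div_mul_cancel₀ d hb]

end SuzukiTypeA

/-! ### Suzuki 2-groups and isomorphisms -/

section SuzukiTwoGroups

theorem IsSuzukiTwoGroup.of_mulEquiv {S S' : Type*} [Group S] [Group S'] (e : S ≃* S')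
    (h : IsSuzukiTwoGroup S) : IsSuzukiTwoGroup S' where
  finite := have := h.finite; Finite.of_equiv S e.toEquiv
  isPGroup := h.isPGroup.of_equiv e
  nonabelian := by
    obtain ⟨a, b, hab⟩ := h.nonabelian
    exact ⟨e a, e b, fun h => hab (e.injective (by rw [map_mul, map_mul, h]))⟩
  two_involutions := by
    obtain ⟨a, b, ha, hb, hab⟩ := h.two_involutions
    exact ⟨e a, e b, by rw [MulEquiv.orderOf_eq, ha], by rw [MulEquiv.orderOf_eq, hb],
      fun h => hab (e.injective h)⟩
  transitive := by
    obtain ⟨A, hA, hA'⟩ := h.transitive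
    refine ⟨A.map (MulAut.congr e).toMonoidHom,
      Group.isSolvable_of_surjective ((MulAut.congr e).toMonoidHom.subgroupMap_surjective A),
      fun a b ha hb => ?_⟩
    obtain ⟨α, hα, hab⟩ := hA' (e.symm a) (e.symm b) (by rw [MulEquiv.orderOf_eq, ha])
      (by rw [MulEquiv.orderOf_eq, hb])
    refine ⟨_, Subgroup.mem_map_of_mem _ hα, ?_⟩
    change e (α (e.symm a)) = b
    rw [hab, MulEquiv.apply_symm_apply]

theorem IsCentralExtensionOfSuzuki.of_mulEquiv {S S' : Type*} [Group S] [Group S'] (e : S ≃* S')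
    (h : IsCentralExtensionOfSuzuki S) : IsCentralExtensionOfSuzuki S' := by
  obtain ⟨Z, hZ, hZc, hS⟩ := h
  have hn : (Z.map e.toMonoidHom).Normal := hZ.map _ e.surjective
  refine ⟨Z.map e.toMonoidHom, hn, ?_, hS.of_mulEquiv (QuotientGroup.congr _ _ e rfl)⟩
  rintro _ ⟨z, hz, rfl⟩
  rw [Subgroup.mem_center_iff]
  intro y
  obtain ⟨y, rfl⟩ := e.surjective y
  change e y * e z = e z * e y
  rw [← map_mul, ← map_mul, Subgroup.mem_center_iff.1 (hZc hz)]

/-- The centre of a nontrivial 2-group contains an involution, and automorphisms preserving the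
centre carry it to every other one. -/
theorem IsSuzukiTwoGroup.mem_center_of_orderOf_eq_two {S : Type*} [Group S]
    (h : IsSuzukiTwoGroup S) {a : S} (ha : orderOf a = 2) : a ∈ Subgroup.center S := by
  have := h.finite
  have : Fact (Nat.Prime 2) := ⟨Nat.prime_two⟩
  obtain ⟨b, c, hbc⟩ := h.nonabelian
  have : Nontrivial S := ⟨⟨b * c, c * b, hbc⟩⟩
  have hnt : Nontrivial (Subgroup.center S) := h.isPGroup.center_nontrivial
  obtain ⟨n, hn⟩ := IsPGroup.iff_card.1 (h.isPGroup.to_subgroup (Subgroup.center S))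
  have hn0 : n ≠ 0 := by
    rintro rfl
    have := Finite.one_lt_card (α := Subgroup.center S)
    omega
  obtain ⟨z, hz⟩ := exists_prime_orderOf_dvd_card' (G := Subgroup.center S) 2
    (by rw [hn]; exact dvd_pow_self 2 hn0)
  obtain ⟨A, -, hA⟩ := h.transitive
  obtain ⟨α, -, hα⟩ := hA z a (by rw [Subgroup.orderOf_coe, hz]) ha
  rw [← hα, Subgroup.mem_center_iff]
  intro y
  obtain ⟨y, rfl⟩ := α.surjective y
  rw [← map_mul, ← map_mul, Subgroup.mem_center_iff.1 z.2]

theorem not_isCentralExtensionOfSuzuki_traceSubgroup :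
    ¬ IsCentralExtensionOfSuzuki traceSubgroup := by
  rintro ⟨Z, hZ, hZc, hS⟩
  have : Fact (Nat.Prime 2) := ⟨Nat.prime_two⟩
  have key (u : traceSubgroup) (hu : u ∉ Z) (hu2 : u * u ∈ Z) (q : traceSubgroup) :
      u * q * u⁻¹ * q⁻¹ ∈ Z := by
    have h1 : orderOf (u : traceSubgroup ⧸ Z) = 2 := by
      rw [orderOf_eq_prime_iff, pow_two, ← QuotientGroup.mk_mul, QuotientGroup.eq_one_iff]
      exact ⟨hu2, fun h => hu ((QuotientGroup.eq_one_iff u).1 h)⟩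
    have h2 := Subgroup.mem_center_iff.1 (hS.mem_center_of_orderOf_eq_two h1) q
    rw [← QuotientGroup.eq_one_iff]
    simp only [QuotientGroup.mk_mul, QuotientGroup.mk_inv]
    rw [← h2]
    group
  -- If `Z` is the whole centre, `1 + x²` is an involution modulo `Z` but lies outside the second
  -- centre. Otherwise some `1 + d x⁴` is missing from `Z`; it is a commutator of an involution `1 +
  -- c x³`, whose image modulo `Z` would have to be central.
  by_cases hall : ∀ d, tq 0 0 0 d (by simp [tr_zero]) ∈ Z
  · have h0 : tr (0 + (0 : F) ^ 4 * 1 + 0 ^ 7) = 0 := by simp [tr_zero]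
    have h1 : tq 0 1 0 0 h0 ∈ Subgroup.upperCentralSeries traceSubgroup 2 := by
      rw [Subgroup.mem_upperCentralSeries_succ_iff]
      intro q
      rw [Subgroup.upperCentralSeries_one]
      refine hZc (key _ (fun h => ?_) ?_ q)
      · exact one_ne_zero (tq_mem_center.1 (hZc h)).2.1
      · obtain ⟨_, h2⟩ := tq_mul_tq (h := h0) (h' := h0)
        rw [h2]
        convert hall 1 using 2 <;> simp [add_self_eq_zero]
    exact one_ne_zero (tq_mem_upperCentralSeries_two.1 h1).2
  · push Not at hall
    obtain ⟨d, hd⟩ := hall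
    obtain ⟨c, hc0, hc⟩ := exists_tr_eq_zero
    have h0 : tr (c + (0 : F) ^ 4 * 0 + 0 ^ 7) = 0 := by simp [hc]
    let b := d / (c ^ 2 + c)
    have hb : b * (c ^ 2 + c) = d := div_mul_cancel₀ d (sq_add_self_ne_zero hc0 hc)
    let q := tq b 0 (b ^ 4 * 0 + b ^ 7) 0 (tr_section b 0)
    have h1 : tq 0 0 c 0 h0 * q = tq 0 0 0 d (by simp [tr_zero]) * (q * tq 0 0 c 0 h0) := by
      obtain ⟨_, h2⟩ := tq_mul_tq (h := tr_section b 0) (h' := h0)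
      obtain ⟨_, h3⟩ := tq_mul_tq (h := h0) (h' := tr_section b 0)
      rw [h2, h3, eq_comm, tq_mul_eq_iff]
      refine ⟨by ring, by ring, by ring, ?_⟩
      linear_combination -hb + b * c ^ 2 * two_eq_zero
    refine hd ?_
    have h2 := key (tq 0 0 c 0 h0) (fun h => hc0 (tq_mem_center.1 (hZc h)).2.2) ?_ q
    · rwa [h1, show ∀ x y z : traceSubgroup, z * (y * x) * x⁻¹ * y⁻¹ = z from
        fun x y z => by group] at h2
    · obtain ⟨_, h2⟩ := tq_mul_tq (h := h0) (h' := h0)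
      rw [h2]
      convert one_mem Z
      rw [← tq_one (h := by simp [tr_zero]), tq_inj]
      simp [add_self_eq_zero]

end SuzukiTwoGroups

/-! ### The quotient by the second centre -/

section Quotient

/-- A surjection of the subgroup of index two onto a Suzuki group of type A. -/
theorem nonempty_quotient_mulEquiv {θ : F ≃+* F} (g : F → F → F)
    (hmul : ∀ a b a' b', g (a + a') (b + b' + a * a' ^ 2) = g a b + θ a * a' + g a' b')
    (hzero : ∀ b, g 0 b = 0 ↔ b = 0) (hsurj : ∀ a, Function.Surjective (g a)) :
    Nonempty ((traceSubgroup ⧸ Subgroup.upperCentralSeries traceSubgroup 2) ≃*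
      suzukiTypeA θ) := by
  let f : traceSubgroup →* suzukiTypeA θ := MonoidHom.mk'
    (fun p => smk θ (cf 1 (p.1 : R)) (g (cf 1 (p.1 : R)) (cf 2 (p.1 : R)))) (fun p q => by
      rw [smk_mul_smk, ← hmul, Subgroup.coe_mul, cf_one_mul p.2.1 q.2.1, cf_two_mul p.2.1 q.2.1])
  have hf (a b c d : F) (h) : f (tq a b c d h) = smk θ a (g a b) := by
    change smk θ (cf 1 (qu a b c d : R)) (g (cf 1 (qu a b c d : R)) (cf 2 (qu a b c d : R))) = _
    rw [qu_one, qu_two]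
  have hker : Subgroup.upperCentralSeries traceSubgroup 2 = f.ker := by
    ext p
    obtain ⟨a, b, c, d, h, rfl⟩ := exists_eq_tq p
    rw [tq_mem_upperCentralSeries_two, MonoidHom.mem_ker, hf, ← smk_zero, smk_inj]
    refine and_congr_right fun ha => ?_
    rw [ha, hzero]
  have hs : Function.Surjective f := fun M => by
    obtain ⟨a, b, rfl⟩ := exists_eq_smk M
    obtain ⟨b, rfl⟩ := hsurj a b
    exact ⟨tq a b _ 0 (tr_section a b), hf _ _ _ _ _⟩
  exact ⟨(QuotientGroup.quotientMulEquivOfEq hker).trans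
    (QuotientGroup.quotientKerEquivOfSurjective f hs)⟩

theorem nonempty_quotient_mulEquiv_of_sq {θ : F ≃+* F} (hθ : ∀ a, θ a = a ^ 2) :
    Nonempty ((traceSubgroup ⧸ Subgroup.upperCentralSeries traceSubgroup 2) ≃*
      suzukiTypeA θ) := by
  -- The cocycles `a a'²` and `a² a'` differ by the coboundary of `a ^ 3`.
  refine nonempty_quotient_mulEquiv (fun a b => b + a ^ 3) (fun a b a' b' => ?_) (fun b => by simp)
    (fun a b => ⟨b - a ^ 3, by ring⟩)
  rw [hθ]
  linear_combination (2 * a * a' ^ 2 + a ^ 2 * a') * two_eq_zero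

theorem nonempty_quotient_mulEquiv_of_ne_one {σ : Gal8} (hσ : σ ≠ 1) :
    Nonempty ((traceSubgroup ⧸ Subgroup.upperCentralSeries traceSubgroup 2) ≃*
      suzukiTypeA (σ : F ≃+* F)) := by
  rcases gal_cases σ with h | h | h
  · exact absurd h hσ
  · exact nonempty_quotient_mulEquiv_of_sq h
  -- The fourth power turns the cocycle `a a'²` into `a⁴ a'⁸ = a⁴ a'`.
  · refine nonempty_quotient_mulEquiv (fun a b => b ^ 4) (fun a b a' b' => ?_) (fun b => by simp)
      (fun a b => pow_four_surjective b)
    have h1 : (σ : F ≃+* F) a = a ^ 4 := h a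
    have := pow_eight a'
    have := two_eq_zero
    rw [h1]
    grind

theorem card_quotient :
    Nat.card (traceSubgroup ⧸ Subgroup.upperCentralSeries traceSubgroup 2) = 64 := by
  obtain ⟨e⟩ := nonempty_quotient_mulEquiv_of_sq (θ := (frob : F ≃+* F)) frob_apply
  rw [Nat.card_congr e.toEquiv, card_suzukiTypeA]

theorem isSuzukiTwoGroup_quotient :
    IsSuzukiTwoGroup (traceSubgroup ⧸ Subgroup.upperCentralSeries traceSubgroup 2) := by
  obtain ⟨e⟩ := nonempty_quotient_mulEquiv_of_sq (θ := (frob : F ≃+* F)) frob_apply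
  exact (isSuzukiTwoGroup_suzukiTypeA (θ := (frob : F ≃+* F)) frob_apply).of_mulEquiv e.symm

end Quotient

/-! ### Conjugacy of elements to their inverses -/

section RealElements

theorem SemiconjBy.odd_pow_inv {Γ : Type*} [Group Γ] {t g : Γ} (h : SemiconjBy t g g⁻¹) {n : ℕ}
    (hn : Odd n) : SemiconjBy (t ^ n) g g⁻¹ := by
  obtain ⟨k, rfl⟩ := hn
  have h2 : Commute (t * t) g := by
    have := h.inv_right.mul_left h
    rwa [inv_inv] at this
  rw [pow_succ', pow_mul, pow_two]
  exact h.mul_left (h2.pow_left k)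

theorem eq_one_of_semiconjBy_inv {Γ : Type*} [Group Γ] (hodd : Odd (Nat.card Γ)) {t g : Γ}
    (h : SemiconjBy t g g⁻¹) : g = 1 := by
  have h1 := SemiconjBy.odd_pow_inv h hodd
  rw [pow_card_eq_one'] at h1
  have h2 : g = g⁻¹ := by simpa [SemiconjBy] using h1
  have h3 : g ^ 2 = 1 := by rw [pow_two]; nth_rewrite 1 [h2]; exact inv_mul_cancel g
  have h4 : orderOf g ∣ 1 := by
    rw [← Nat.Coprime.gcd_eq_one (Nat.coprime_two_left.2 hodd)]
    exact Nat.dvd_gcd (orderOf_dvd_of_pow_eq_one h3) (orderOf_dvd_natCard g)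
  exact orderOf_eq_one_iff.1 (Nat.dvd_one.1 h4)

/-- The image of `g` in the odd-order group `K` is real, hence trivial. An odd power of `t` still
inverts `g`, and the power with exponent `Nat.card K` lies in `N`. -/
theorem exists_inl_of_semiconjBy_inv {N K : Type*} [Group N] [Group K] {φ : K →* MulAut N}
    (hodd : Odd (Nat.card K)) {t g : N ⋊[φ] K} (h : SemiconjBy t g g⁻¹) :
    ∃ u q : N, g = SemidirectProduct.inl u ∧ SemiconjBy q u u⁻¹ := by
  have hg : g.right = 1 := by
    have := h.map (SemidirectProduct.rightHom : N ⋊[φ] K →* K)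
    rw [map_inv] at this
    exact eq_one_of_semiconjBy_inv hodd this
  have ht : (t ^ Nat.card K).right = 1 := by
    change SemidirectProduct.rightHom (t ^ Nat.card K) = 1
    rw [map_pow, pow_card_eq_one']
  have h1 := SemiconjBy.odd_pow_inv h hodd
  have hg' : g = SemidirectProduct.inl g.left := SemidirectProduct.ext rfl hg
  have ht' : t ^ Nat.card K = SemidirectProduct.inl (t ^ Nat.card K).left :=
    SemidirectProduct.ext rfl ht
  refine ⟨g.left, (t ^ Nat.card K).left, hg', ?_⟩
  rw [ht', hg', ← map_inv] at h1
  refine SemidirectProduct.inl_injective (φ := φ) ?_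
  rw [map_mul, map_mul]
  exact h1

theorem isConj_inl_iff {N K : Type*} [Group N] [Group K] {φ : K →* MulAut N} {u v : N} :
    IsConj (SemidirectProduct.inl u : N ⋊[φ] K) (SemidirectProduct.inl v) ↔
      ∃ p k, p * φ k u * p⁻¹ = v := by
  have key (p : N) (k : K) : (SemidirectProduct.inl p * SemidirectProduct.inr k : N ⋊[φ] K) *
      SemidirectProduct.inl u * (SemidirectProduct.inl p * SemidirectProduct.inr k)⁻¹ =
      SemidirectProduct.inl (p * φ k u * p⁻¹) := by
    rw [map_mul, map_mul, SemidirectProduct.inl_aut, mul_inv_rev, map_inv, map_inv]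
    group
  rw [isConj_iff]
  constructor
  · rintro ⟨c, hc⟩
    rw [← SemidirectProduct.inl_left_mul_inr_right c, key] at hc
    exact ⟨_, _, SemidirectProduct.inl_injective hc⟩
  · rintro ⟨p, k, rfl⟩
    exact ⟨_, key p k⟩

theorem leading_coeffs_of_semiconjBy_inv {u q : traceSubgroup} (h : SemiconjBy q u u⁻¹) :
    ∃ c d h, u = tq 0 0 c d h := by
  have h1 : u * q * u = q := by
    rw [mul_assoc, h.eq, mul_inv_cancel_left]
  obtain ⟨a, b, c, d, hu, rfl⟩ := exists_eq_tq u
  obtain ⟨a', b', c', d', hq, rfl⟩ := exists_eq_tq q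
  obtain ⟨_, h2⟩ := tq_mul_tq (h := hu) (h' := hq)
  rw [h2, tq_mul_eq_iff] at h1
  obtain ⟨-, h3, h4, h5⟩ := h1
  have h20 := two_eq_zero
  have ha : a = 0 := by
    by_contra ha
    -- The `x²` coefficient of `u q u = q` is `a (a'² + a a' + a²) = 0`.
    refine sq_add_self_add_one_ne_zero (a' / a) ?_
    field_simp
    refine mul_left_cancel₀ ha ?_
    linear_combination h3 - b * h20
  subst ha
  have hb : b = 0 := by
    by_contra hb
    have h6 : b * b' ^ 4 + b' * b ^ 4 + b ^ 5 + c * a' + a' * c ^ 2 = 0 := by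
      linear_combination h5 - d * h20
    have h7 : a' * (b * (a' ^ 3 - b)) = 0 := by linear_combination h4 - (c + a' * b ^ 2) * h20
    -- The `x⁴` equation divided by `b ^ 5`. By the `x³` equation `a' = 0` or `a' ^ 3 = b`; in the
    -- latter case `a' = b ^ 5` and `e = c + c ^ 2`. Either way the sum has trace `1`.
    obtain ⟨e, h10, h8⟩ : ∃ e, tr e = 0 ∧ (b' / b) ^ 4 + b' / b + 1 + e = 0 := by
      by_cases ha' : a' = 0
      · refine ⟨0, tr_zero, ?_⟩
        subst ha'
        field_simp
        refine mul_left_cancel₀ hb ?_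
        linear_combination h6
      · refine ⟨c + c ^ 2, by rw [tr_add, tr_sq, add_self_eq_zero], ?_⟩
        have h9 : a' ^ 3 = b := by simpa [ha', hb, sub_eq_zero] using h7
        have h10 : a' = b ^ 5 := by
          rw [← h9]; linear_combination -(a' ^ 7 + 1) * pow_eight a'
        rw [h10] at h6
        field_simp
        refine mul_left_cancel₀ hb ?_
        linear_combination h6
    have h9 := congrArg tr h8
    rw [tr_add, h10, tr_add, tr_add, tr_pow_four, add_self_eq_zero, tr_one, tr_zero, zero_add,
      add_zero] at h9
    exact one_ne_zero h9
  subst hb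
  exact ⟨c, d, hu, rfl⟩

end RealElements

/-! ### The group `C𝒢` -/

section FrobeniusGroup

theorem card_CG : Nat.card CG = 21 := by
  rw [SemidirectProduct.card, Nat.card_units, card_F, card_Gal8]

instance : Finite CG := Nat.finite_of_card_ne_zero (by rw [card_CG]; norm_num)

/-- If `g ρ = σ g` with `σ ≠ 1`, comparing left components shows that `σ` fixes `g.left`; hence
`g.left = 1` and `g` lies in the complement. -/
theorem isFrobeniusComplement_Gal8 :
    IsFrobeniusComplement (SemidirectProduct.inr : Gal8 →* CG).range := by
  have hfrob : frob ≠ 1 := by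
    intro h
    obtain ⟨t, ht0, ht1⟩ := exists_ne_zero_ne 1
    have h1 : t ^ 2 = t := by rw [← frob_apply, h]; rfl
    exact ht1 (mul_left_cancel₀ ht0 (by linear_combination h1))
  refine ⟨fun h => ?_, fun h => ?_, fun g hg => ?_⟩
  · have h1 : (SemidirectProduct.inr frob : CG) ∈ (⊥ : Subgroup CG) := h ▸ ⟨frob, rfl⟩
    rw [Subgroup.mem_bot, ← map_one SemidirectProduct.inr] at h1
    exact hfrob (SemidirectProduct.inr_injective h1)
  · obtain ⟨t, ht0, ht1⟩ := exists_ne_zero_ne 1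
    have h1 : (SemidirectProduct.inl (Units.mk0 t ht0) : CG) ∈
      (SemidirectProduct.inr : Gal8 →* CG).range := h ▸ Subgroup.mem_top _
    obtain ⟨σ, hσ⟩ := h1
    have h2 := congrArg (fun k : CG => (k.left : F)) hσ
    exact ht1 (by simpa using h2.symm)
  · rw [eq_bot_iff]
    rintro _ ⟨⟨σ, rfl⟩, ⟨_, ⟨ρ, rfl⟩, h⟩⟩
    have h0 : g * SemidirectProduct.inr ρ = SemidirectProduct.inr σ * g := by
      rw [← h]
      simp
    have hr := congrArg (fun k : CG => (k.left : F)) h0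
    have h1 : σ (g.left : F) = g.left := by simpa using hr.symm
    rw [Subgroup.mem_bot]
    by_contra hσ
    have hσ' : σ ≠ 1 := by rintro rfl; exact hσ (map_one _)
    have h2 := gal_fixed hσ' g.left.ne_zero h1
    exact hg ⟨g.right, SemidirectProduct.ext (Units.ext h2.symm) rfl⟩

end FrobeniusGroup

/-! ### The group `G` -/

section SemidirectProductGroup

variable (hP : IsInvariant traceSubgroup)

instance : Finite (G traceSubgroup hP) := Finite.of_equiv _ SemidirectProduct.equivProd.symm

theorem actOn_tq (k : CG) (a b c d : F) (h) : ∃ h', actOn traceSubgroup hP k (tq a b c d h) =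
    tq (k.left ^ 6 * k.right a) (k.left ^ 4 * k.right b) (k.right c) (k.left ^ 6 * k.right d) h' := by
  have h1 := (actOn traceSubgroup hP k (tq a b c d h)).2
  have h2 : (actOn traceSubgroup hP k (tq a b c d h) : Rˣ) = actCG k (qu a b c d) := rfl
  rw [actCG_qu] at h2
  rw [h2] at h1
  exact ⟨qu_mem_traceSubgroup.1 h1, Subtype.ext h2⟩

theorem mem_center_of_isConj_inl {N K : Type*} [Group N] [Group K] {φ : K →* MulAut N} {u v : N}
    (h : IsConj (SemidirectProduct.inl u : N ⋊[φ] K) (SemidirectProduct.inl v))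
    (hu : u ∈ Subgroup.center N) : v ∈ Subgroup.center N := by
  obtain ⟨p, k, rfl⟩ := isConj_inl_iff.1 h
  have h1 : φ k u ∈ Subgroup.center N := by
    rw [Subgroup.mem_center_iff]
    intro y
    obtain ⟨y, rfl⟩ := (φ k).surjective y
    rw [← map_mul, ← map_mul, Subgroup.mem_center_iff.1 hu]
  rwa [Subgroup.mem_center_iff.1 h1 p, mul_inv_cancel_right]

theorem ncard_realClasses :
    {k : ConjClasses (G traceSubgroup hP) | invClass k = k}.ncard = 3 := by
  obtain ⟨e, he0, he⟩ := exists_tr_eq_zero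
  let z : traceSubgroup := tq 0 0 0 1 (by simp [tr_zero])
  let w : traceSubgroup := tq 0 0 e 0 (by simp [he])
  have hz1 : z ≠ 1 := by
    rw [← tq_one (h := by simp [tr_zero]), ne_eq, tq_inj]; simp
  have hw : w ∉ Subgroup.center traceSubgroup := fun h => he0 (tq_mem_center.1 h).2.2
  have hz : z ∈ Subgroup.center traceSubgroup := tq_mem_center.2 ⟨rfl, rfl, rfl⟩
  have hinv (c d h) : (tq 0 0 c d h)⁻¹ = tq 0 0 c d h := by
    rw [inv_eq_iff_mul_eq_one, ← tq_one (h := by simp [tr_zero]), tq_mul_eq_iff]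
    simp [add_self_eq_zero]
  have hreal (c d h) : invClass (ConjClasses.mk
      (SemidirectProduct.inl (tq 0 0 c d h) : G traceSubgroup hP)) =
      ConjClasses.mk (SemidirectProduct.inl (tq 0 0 c d h)) := by
    rw [invClass_mk, ← map_inv, hinv]
  rw [Set.ncard_eq_three]
  refine ⟨ConjClasses.mk (SemidirectProduct.inl 1), ConjClasses.mk (SemidirectProduct.inl z),
    ConjClasses.mk (SemidirectProduct.inl w), fun h => ?_, fun h => ?_, fun h => ?_, ?_⟩
  · rw [ConjClasses.mk_eq_mk_iff_isConj, map_one, isConj_one_right] at h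
    exact hz1 (SemidirectProduct.inl_injective (h.trans (map_one _).symm))
  · exact hw (mem_center_of_isConj_inl (ConjClasses.mk_eq_mk_iff_isConj.1 h) (one_mem _))
  · exact hw (mem_center_of_isConj_inl (ConjClasses.mk_eq_mk_iff_isConj.1 h) hz)
  · ext k
    rw [Set.mem_insert_iff, Set.mem_insert_iff, Set.mem_singleton_iff]
    constructor
    · obtain ⟨g, rfl⟩ := ConjClasses.mk_surjective k
      intro hg
      change invClass _ = _ at hg
      rw [invClass_mk, eq_comm, ConjClasses.mk_eq_mk_iff_isConj, isConj_iff] at hg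
      obtain ⟨t, ht⟩ := hg
      obtain ⟨u, q, rfl, hq⟩ := exists_inl_of_semiconjBy_inv (by rw [card_CG]; decide)
        (show SemiconjBy t g g⁻¹ from (mul_inv_eq_iff_eq_mul.1 ht))
      obtain ⟨c, d, h, rfl⟩ := leading_coeffs_of_semiconjBy_inv hq
      by_cases hc : c = 0
      · subst hc
        by_cases hd : d = 0
        · subst hd
          left
          rw [tq_one]
        · right; left
          rw [eq_comm, ConjClasses.mk_eq_mk_iff_isConj, isConj_inl_iff]
          -- `C` acts on the quartic coefficient by sixth powers, and `(d ^ 6) ^ 6 = d`.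
          refine ⟨1, SemidirectProduct.inl (Units.mk0 (d ^ 6) (pow_ne_zero _ hd)), ?_⟩
          obtain ⟨_, h1⟩ := actOn_tq hP
            (SemidirectProduct.inl (Units.mk0 (d ^ 6) (pow_ne_zero _ hd))) 0 0 0 1
            (by simp [tr_zero])
          rw [one_mul, inv_one, mul_one, h1, tq_inj]
          simp only [SemidirectProduct.left_inl, Units.val_mk0, SemidirectProduct.right_inl,
            map_zero, mul_zero, map_one, mul_one, true_and]
          linear_combination (d ^ 28 + d ^ 21 + d ^ 14 + d ^ 7 + 1) * pow_eight d
      · right; right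
        have hc' : tr c = 0 := by simpa using h
        obtain ⟨σ, rfl⟩ : ∃ σ : Gal8, σ e = c := by
          rcases conjugate_of_tr_eq_zero he0 hc he hc' with rfl | rfl | rfl
          · exact ⟨1, rfl⟩
          · exact ⟨frob, frob_apply e⟩
          · exact ⟨frob * frob, frob_frob_apply e⟩
        -- Conjugating `1 + c x³` by an element with linear coefficient `b` adds `b (c² + c)` to the
        -- quartic coefficient; here `c = σ e`.
        let b := d / (σ e ^ 2 + σ e)
        have hb : b * (σ e ^ 2 + σ e) = d :=
          div_mul_cancel₀ d (sq_add_self_ne_zero hc hc')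
        rw [eq_comm, ConjClasses.mk_eq_mk_iff_isConj, isConj_inl_iff]
        refine ⟨tq b 0 (b ^ 4 * 0 + b ^ 7) 0 (tr_section b 0), SemidirectProduct.inr σ, ?_⟩
        obtain ⟨_, h1⟩ := actOn_tq hP (SemidirectProduct.inr σ) 0 0 e 0 (by simp [he])
        obtain ⟨_, h2⟩ := tq_mul_tq (h := h) (h' := tr_section b 0)
        rw [mul_inv_eq_iff_eq_mul, h1, h2, tq_mul_eq_iff]
        simp only [SemidirectProduct.left_inr, SemidirectProduct.right_inr, map_zero, mul_zero]
        refine ⟨by ring, by ring, by ring, ?_⟩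
        linear_combination hb - b * σ e * two_eq_zero
    · rintro (rfl | rfl | rfl)
      · change invClass _ = _
        rw [invClass_mk, map_one, inv_one]
      · exact hreal _ _ _
      · exact hreal _ _ _

theorem sylow_eq_range_inl (S : Sylow 2 (G traceSubgroup hP)) :
    (S : Subgroup (G traceSubgroup hP)) =
      (SemidirectProduct.inl : traceSubgroup →* G traceSubgroup hP).range := by
  have : Fact (Nat.Prime 2) := ⟨Nat.prime_two⟩
  set N := (SemidirectProduct.inl : traceSubgroup →* G traceSubgroup hP).range with hN
  have hNn : N.Normal := by
    rw [hN, SemidirectProduct.range_inl_eq_ker_rightHom]; infer_instance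
  have hcard : Nat.card N = 2 ^ 11 := by
    rw [← card_traceSubgroup]
    exact (Nat.card_congr (MonoidHom.ofInjective SemidirectProduct.inl_injective).toEquiv).symm
  have hindex : N.index = 21 := by
    have h := N.card_mul_index
    rw [hcard, SemidirectProduct.card, card_traceSubgroup, card_CG] at h
    omega
  let T : Sylow 2 (G traceSubgroup hP) :=
    (IsPGroup.of_card hcard).toSylow (by rw [hindex]; norm_num)
  have hT : (T : Subgroup (G traceSubgroup hP)) = N := rfl
  obtain ⟨g, hg⟩ := MulAction.exists_smul_eq (G traceSubgroup hP) T S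
  have hTn : (T : Subgroup (G traceSubgroup hP)).Normal := hNn
  rw [← hg, Sylow.smul_eq_of_normal, hT]

/-- Stated up to isomorphism so that it also covers the copy of the subgroup inside `G`. -/
theorem not_mem_list_of_mulEquiv {S : Type*} [Group S] (e : traceSubgroup ≃* S) :
    ¬ (IsCyclic S ∨ IsHomocyclic S ∨ Nonempty (S ≃* QuaternionGroup 2) ∨
      IsCentralExtensionOfSuzuki S) := by
  have hnc : ¬ ∀ a b : S, a * b = b * a := by
    intro h
    obtain ⟨a, b, hab⟩ := isSuzukiTwoGroup_quotient.nonabelian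
    obtain ⟨a, rfl⟩ := QuotientGroup.mk_surjective a
    obtain ⟨b, rfl⟩ := QuotientGroup.mk_surjective b
    refine hab ?_
    rw [← QuotientGroup.mk_mul, ← QuotientGroup.mk_mul]
    exact congrArg _ (e.injective (by rw [map_mul, map_mul, h]))
  rintro (h | ⟨k, n, -, ⟨f⟩⟩ | ⟨⟨f⟩⟩ | h)
  · exact hnc IsCyclic.isMulCommutative.is_comm.comm
  · exact hnc fun a b => f.injective (by rw [map_mul, map_mul, mul_comm])
  · have h1 := Nat.card_congr (e.trans f).toEquiv
    rw [card_traceSubgroup, Nat.card_eq_fintype_card, QuaternionGroup.card] at h1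
    norm_num at h1
  · exact not_isCentralExtensionOfSuzuki_traceSubgroup (h.of_mulEquiv e.symm)

end SemidirectProductGroup

end

end ThreeReal

open ThreeReal in
theorem mainTheorem1 :
    (Nat.card F = 8 ∧ Nat.card CG = 21 ∧
      IsFrobeniusComplement (SemidirectProduct.inr : Gal8 →* CG).range) ∧
    (∃! P : Subgroup Rˣ, IsInvariantIndexTwo P) ∧
    (∀ (P : Subgroup Rˣ) (hP : IsInvariantIndexTwo P),
      (realIrrChars (G P hP.invariant)).ncard = 3 ∧
      (Nat.card P = 2 ^ 11 ∧
        ∀ S : Sylow 2 (G P hP.invariant),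
          (S : Subgroup (G P hP.invariant)) =
            (SemidirectProduct.inl : P →* G P hP.invariant).range) ∧
      (Nat.card (P ⧸ Subgroup.upperCentralSeries P 2) = 64 ∧
        IsSuzukiTwoGroup (P ⧸ Subgroup.upperCentralSeries P 2) ∧
        ∀ θ : Gal8, θ ≠ 1 →
          Nonempty ((P ⧸ Subgroup.upperCentralSeries P 2) ≃*
            suzukiTypeA (θ : F ≃+* F))) ∧
      IsIteratedCentralExtensionOfSuzuki P ∧
      ¬ (IsCyclic P ∨ IsHomocyclic P ∨ Nonempty (P ≃* QuaternionGroup 2) ∨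
        IsCentralExtensionOfSuzuki P)) ∧
    ¬ (∀ (Γ : Type) [Group Γ] [Finite Γ], (realIrrChars Γ).ncard = 3 →
        ∀ S : Sylow 2 Γ, IsInListWithoutIterated (S : Subgroup Γ)) := by
  refine ⟨⟨card_F, card_CG, isFrobeniusComplement_Gal8⟩,
    ⟨traceSubgroup, isInvariantIndexTwo_traceSubgroup, fun P hP => hP.eq_traceSubgroup⟩,
    fun P hP => ?_, fun h => ?_⟩
  · obtain rfl := hP.eq_traceSubgroup
    exact ⟨ncard_realIrrChars.trans (ncard_realClasses hP.invariant),
      ⟨card_traceSubgroup, sylow_eq_range_inl hP.invariant⟩,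
      ⟨card_quotient, isSuzukiTwoGroup_quotient,
        fun θ hθ => nonempty_quotient_mulEquiv_of_ne_one hθ⟩,
      ⟨2, le_rfl, isSuzukiTwoGroup_quotient⟩, not_mem_list_of_mulEquiv (MulEquiv.refl _)⟩
  · have hP := isInvariantIndexTwo_traceSubgroup.invariant
    have S : Sylow 2 (G traceSubgroup hP) := default
    have h1 := h _ (ncard_realIrrChars.trans (ncard_realClasses hP)) S
    rw [sylow_eq_range_inl hP S] at h1
    refine not_mem_list_of_mulEquiv
      (MonoidHom.ofInjective (SemidirectProduct.inl_injective (φ := actOn traceSubgroup hP))) ?_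
    exact h1.imp id And.right
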